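/- Let $p$ be an odd prime, $X=\{0,\dots,p-1\}$, and let $X^*$ be the rooted $p$-regular tree of finite words over $X$. For $g\in\operatorname{Aut}(X^*)$ and a word $u$, the section $g|_u\in\operatorname{Aut}(X^*)$ is determined by $g(uv)=g(u)\,g|_u(v)$ for all words $v$; let $\operatorname{Stab}(1)$ be the subgroup of all $g$ that fix every vertex of the first level $X$, and let $$\psi\colon \operatorname{Stab}(1)\to \operatorname{Aut}(X^*)^{X},\qquad g\mapsto (g|_x)_{x\in X}.$$ Let $\mathbf e=(e_1,\dots,e_{p-1})\in\mathbb F_p^{p-1}$ be a non-constant tuple and let $G=G_{\mathbf e}=\langle a,b\rangle\le\operatorname{Aut}(X^*)$ be the GGS-group defined by $\mathbf e$: the automorphism $a$ permutes the first letter of every word by the cycle $(0\;1\;\dots\;p-1)$ and leaves the other letters unchanged, and $b\in\operatorname{Stab}(1)$ is defined recursively by $\psi(b)=(b,a^{e_1},\dots,a^{e_{p-1}})$. Let $\mathbf e'=(e_{i-1}-e_i)_{2\le i\le p-1}$ be the tuple of differences of $\mathbf e$, and let $\mathbf e''=(e'_{i-1}-e'_i)_{3\le i\le p-1}$ be the tuple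 of differences of $\mathbf e'$ (for $p=3$ it is empty). Put $\operatorname{con}(\mathbf d)=1$ if all entries of the tuple $\mathbf d$ agree and $\operatorname{con}(\mathbf d)=0$ otherwise, and $\operatorname{sym}(\mathbf d)=1$ if the $i$-th entry of $\mathbf d$ equals its $i$-th-to-last entry for every $i$ and $\operatorname{sym}(\mathbf d)=0$ otherwise (the empty tuple is symmetric). The group $G'/\gamma_3(G)$, where $\gamma_3(G)=[[G,G],G]$, is elementary abelian, hence an $\mathbb F_p$-vector space. Let $V=(G'/\gamma_3(G))^{X}$ be the space of $p$-tuples, and let $C\colon V\to V$ be the cyclic shift of the coordinates. For $v\in V$ let $\operatorname{Circ}(v)$ be the smallest $C$-invariant subspace containing $v$, and put $\operatorname{Circ}_j(V)=\{v\in V\mid \dim\operatorname{Circ}(v)\le j\}$. Let $\pi\colon G'\to G'/\gamma_3(G)$ be the quotient map. Then $G''\le\operatorname{Stab}(1)$, and $$\psi(G'')=\bigl\{(g_0,\dots,g_{p-1})\in G'\times\dots\times G' \;\big|\; (\pi(g_0),\dots,\pi(g_{p-1}))\in \operatorname{Circ}_{p-i}(V)\bigr\},\qquad i=\operatorname{con}(\mathbf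 e')+\operatorname{sym}(\mathbf e'').$$ -/

import Mathlib

namespace GGS

/-! ## Automorphisms of a regular rooted tree -/

section Tree

/-- The rooted regular tree on the finite words over the alphabet `X`: the Cayley graph of the free
monoid on `X`. Two words are adjacent when one is obtained from the other by appending a letter. -/
def tree (X : Type) : SimpleGraph (List X) :=
  SimpleGraph.fromRel (fun u v => ∃ x, v = u ++ [x])

/-- The group of graph automorphisms of the tree, with the multiplication of Mathlib,
`(g * h) u = g (h u)`. (Reversing the order of composition changes none of the subgroups
considered below.) -/
abbrev TreeAut (X : Type) : Type := tree X ≃g tree X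

variable {X : Type}

theorem tree_adj (u v : List X) :
    (tree X).Adj u v ↔ (∃ x, v = u ++ [x]) ∨ (∃ x, u = v ++ [x]) := by
  simp only [tree, SimpleGraph.fromRel_adj, and_iff_right_iff_imp, ne_eq]
  rintro (⟨x, rfl⟩ | ⟨x, rfl⟩) h <;> simp at h

/-- An automorphism fixes the root, since the root has fewer neighbours than any other vertex. -/
theorem map_nil [Finite X] (g : TreeAut X) : g [] = [] := by
  by_contra hne
  obtain ⟨w, z, hw⟩ : ∃ w z, g [] = w ++ [z] :=
    ⟨_, _, (List.dropLast_append_getLast hne).symm⟩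
  have hadj : ∀ v, (tree X).Adj (g []) v → ∃ x : X, g [x] = v := by
    intro v hv
    have h1 : (tree X).Adj [] (g.symm v) := by
      rw [← g.map_adj_iff]; simpa using hv
    rw [tree_adj] at h1
    rcases h1 with ⟨x, hx⟩ | ⟨x, hx⟩
    · refine ⟨x, ?_⟩
      rw [List.nil_append] at hx
      rw [← hx]; simp
    · simp at hx
  have hch : ∀ o : Option X, ∃ x : X, g [x] =
      (match o with | none => w | some y => w ++ [z] ++ [y]) := by
    rintro (_ | y)
    · exact hadj _ (by rw [hw, tree_adj]; exact Or.inr ⟨z, rfl⟩)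
    · exact hadj _ (by rw [hw, tree_adj]; exact Or.inl ⟨y, rfl⟩)
  choose f hf using hch
  have hinj : Function.Injective f := by
    intro o o' h
    have := (hf o).symm.trans ((congrArg (fun x => g [x]) h).trans (hf o'))
    rcases o with _ | y <;> rcases o' with _ | y'
    · rfl
    · have := congrArg List.length this; simp at this
    · have := congrArg List.length this; simp at this
    · simpa using this
  have := Fintype.ofFinite X
  have := Fintype.card_le_of_injective f hinj
  simp at this

/-- An automorphism maps the children of a vertex to the children of its image. -/
theorem map_child [Finite X] (g : TreeAut X) (u : List X) :
    ∀ x, ∃ y, g (u ++ [x]) = g u ++ [y] := by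
  induction u using List.reverseRecOn with
  | nil =>
    intro x
    have h : (tree X).Adj (g []) (g ([] ++ [x])) := by
      rw [g.map_adj_iff, tree_adj]; exact Or.inl ⟨x, rfl⟩
    rw [tree_adj, map_nil] at h
    rcases h with ⟨y, hy⟩ | ⟨y, hy⟩
    · exact ⟨y, by rw [hy, map_nil]⟩
    · simp at hy
  | append_singleton w z ih =>
    intro x
    have h : (tree X).Adj (g (w ++ [z])) (g (w ++ [z] ++ [x])) := by
      rw [g.map_adj_iff, tree_adj]; exact Or.inl ⟨x, rfl⟩
    rw [tree_adj] at h
    rcases h with h | ⟨y, hy⟩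
    · exact h
    · exfalso
      obtain ⟨z', hz'⟩ := ih z
      rw [hz'] at hy
      have h2 := g.injective (List.append_inj_left' hy rfl)
      have := congrArg List.length h2
      simp at this

theorem map_append [Finite X] (g : TreeAut X) (u v : List X) :
    g (u ++ v) = g u ++ (g (u ++ v)).drop u.length ∧ (g u).length = u.length := by
  have hlen : ∀ u, (g u).length = u.length := by
    intro u
    induction u using List.reverseRecOn with
    | nil => rw [map_nil]
    | append_singleton w z ih => obtain ⟨y, hy⟩ := map_child g w z; simp [hy, ih]
  refine ⟨?_, hlen u⟩
  obtain ⟨s, hs⟩ : ∃ s, g (u ++ v) = g u ++ s := by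
    induction v using List.reverseRecOn with
    | nil => exact ⟨[], by simp⟩
    | append_singleton w z ih =>
      obtain ⟨s, hs⟩ := ih
      obtain ⟨y, hy⟩ := map_child g (u ++ w) z
      exact ⟨s ++ [y], by rw [← List.append_assoc, hy, hs, List.append_assoc]⟩
  rw [hs, ← hlen u, List.drop_left]

/-- A permutation of the words that, like its inverse, maps children to children, as an
automorphism of the tree. -/
def ofPerm (f : Equiv.Perm (List X)) (h : ∀ u x, ∃ y, f (u ++ [x]) = f u ++ [y])
    (h' : ∀ u x, ∃ y, f.symm (u ++ [x]) = f.symm u ++ [y]) : TreeAut X where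
  toEquiv := f
  map_rel_iff' := by
    intro u v
    rw [tree_adj, tree_adj]
    constructor
    · rintro (⟨x, hx⟩ | ⟨x, hx⟩)
      · obtain ⟨y, hy⟩ := h' (f u) x
        exact Or.inl ⟨y, by rw [← hx] at hy; simpa using hy⟩
      · obtain ⟨y, hy⟩ := h' (f v) x
        exact Or.inr ⟨y, by rw [← hx] at hy; simpa using hy⟩
    · rintro (⟨x, rfl⟩ | ⟨x, rfl⟩)
      · exact Or.inl (h u x)
      · exact Or.inr (h v x)

/-- The section `g|_u` of `g` at the vertex `u`: the automorphism with
`g (u ++ v) = g u ++ (g|_u) v`. -/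
def sect [Finite X] (g : TreeAut X) (u : List X) : TreeAut X :=
  ofPerm
    { toFun := fun v => (g (u ++ v)).drop u.length
      invFun := fun v => (g.symm (g u ++ v)).drop u.length
      left_inv := by
        intro v
        change (g.symm (g u ++ (g (u ++ v)).drop u.length)).drop u.length = v
        rw [← (map_append g u v).1]; simp
      right_inv := by
        intro v
        change (g (u ++ (g.symm (g u ++ v)).drop u.length)).drop u.length = v
        have h := map_append g.symm (g u) v
        rw [(map_append g u []).2, RelIso.symm_apply_apply] at h
        rw [← h.1, RelIso.apply_symm_apply, ← (map_append g u []).2, List.drop_left] }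
    (by
      intro v x
      change ∃ y, (g (u ++ (v ++ [x]))).drop u.length = (g (u ++ v)).drop u.length ++ [y]
      obtain ⟨y, hy⟩ := map_child g (u ++ v) x
      refine ⟨y, ?_⟩
      rw [← List.append_assoc, hy, List.drop_append_of_le_length]
      rw [(map_append g (u ++ v) []).2]; simp)
    (by
      intro v x
      change ∃ y, (g.symm (g u ++ (v ++ [x]))).drop u.length =
        (g.symm (g u ++ v)).drop u.length ++ [y]
      obtain ⟨y, hy⟩ := map_child g.symm (g u ++ v) x
      refine ⟨y, ?_⟩
      rw [← List.append_assoc, hy, List.drop_append_of_le_length]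
      rw [(map_append g.symm (g u ++ v) []).2]; simp [(map_append g u []).2])

theorem apply_append [Finite X] (g : TreeAut X) (u v : List X) :
    g (u ++ v) = g u ++ sect g u v :=
  (map_append g u v).1

/-- The (pointwise) stabiliser `Stab(n)` of the `n`-th level of the tree. -/
def stab (X : Type) (n : ℕ) : Subgroup (TreeAut X) where
  carrier := {g | ∀ u : List X, u.length = n → g u = u}
  one_mem' := fun _ _ => rfl
  mul_mem' := by
    intro g h hg hh u hu
    change g (h u) = u
    rw [hh u hu, hg u hu]
  inv_mem' := by
    intro g hg u hu
    change g.symm u = u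
    rw [RelIso.symm_apply_eq, hg u hu]

/-- The homomorphism `ψ : Stab(1) → Aut × ⋯ × Aut`, `g ↦ (g|_x)_{x ∈ X}`. -/
def psi (X : Type) [Finite X] : stab X 1 →* (X → TreeAut X) where
  toFun g := fun x => sect g.1 [x]
  map_one' := rfl
  map_mul' := by
    intro g h
    funext x
    ext1 v
    change ((g.1 (h.1 ([x] ++ v))).drop 1) = sect g.1 [x] (sect h.1 [x] v)
    rw [apply_append h.1, h.2 [x] rfl, apply_append g.1, g.2 [x] rfl]
    rfl

/-- The rooted automorphism that acts on the first letter of a word by the permutation `σ`. -/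
def rooted (σ : Equiv.Perm X) : TreeAut X :=
  ofPerm
    { toFun := fun | [] => [] | x :: v => σ x :: v
      invFun := fun | [] => [] | x :: v => σ.symm x :: v
      left_inv := by rintro (_ | ⟨x, v⟩) <;> simp
      right_inv := by rintro (_ | ⟨x, v⟩) <;> simp }
    (by rintro (_ | ⟨z, v⟩) x <;> simp)
    (by rintro (_ | ⟨z, v⟩) x <;> simp)

end Tree

/-! ## GGS-groups -/

section Groups

variable (p : ℕ)

/-- The rooted automorphism `a = (0 1 … p-1)`. -/
def genA : TreeAut (Fin p) := rooted (finRotate p)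

variable {p}

/-- The action of the directed generator on words. The entry `e_i`, `1 ≤ i ≤ p - 1`, of the
defining tuple is `e ⟨i - 1, _⟩`. -/
def dirFun (e : Fin (p - 1) → ZMod p) : List (Fin p) → List (Fin p)
  | [] => []
  | x :: v =>
    if h : (x : ℕ) = 0 then x :: dirFun e v
    else x :: (genA p ^ (e ⟨x - 1, by omega⟩).val) v

/-- The action of the inverse of the directed generator on words. -/
def dirInv (e : Fin (p - 1) → ZMod p) : List (Fin p) → List (Fin p)
  | [] => []
  | x :: v =>
    if h : (x : ℕ) = 0 then x :: dirInv e v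
    else x :: ((genA p ^ (e ⟨x - 1, by omega⟩).val)⁻¹) v

/-- The directed automorphism `b` defined by `ψ(b) = (b, a^{e_1}, …, a^{e_{p-1}})`. -/
def genB (e : Fin (p - 1) → ZMod p) : TreeAut (Fin p) :=
  ofPerm
    { toFun := dirFun e
      invFun := dirInv e
      left_inv := by
        intro v
        induction v with
        | nil => rfl
        | cons x v ih =>
          by_cases h : (x : ℕ) = 0
          · simp [dirFun, dirInv, h, ih]
          · simp only [dirFun, dirInv, h, dite_false]
            rw [← RelIso.mul_apply, inv_mul_cancel]; rfl
      right_inv := by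
        intro v
        induction v with
        | nil => rfl
        | cons x v ih =>
          by_cases h : (x : ℕ) = 0
          · simp [dirFun, dirInv, h, ih]
          · simp only [dirFun, dirInv, h, dite_false]
            rw [← RelIso.mul_apply, mul_inv_cancel]; rfl }
    (by
      intro u y
      change ∃ z, dirFun e (u ++ [y]) = dirFun e u ++ [z]
      induction u with
      | nil => by_cases h : (y : ℕ) = 0 <;> simp [dirFun, h, map_nil]
      | cons x v ih =>
        by_cases h : (x : ℕ) = 0
        · simpa [dirFun, h] using ih
        · simpa [dirFun, h] using map_child _ v y)
    (by
      intro u y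
      change ∃ z, dirInv e (u ++ [y]) = dirInv e u ++ [z]
      induction u with
      | nil => by_cases h : (y : ℕ) = 0 <;> simp [dirInv, h, map_nil]
      | cons x v ih =>
        by_cases h : (x : ℕ) = 0
        · simpa [dirInv, h] using ih
        · simpa [dirInv, h] using map_child _ v y)

/-- The GGS-group `G_e` defined by the tuple `e`. -/
def ggs (e : Fin (p - 1) → ZMod p) : Subgroup (TreeAut (Fin p)) :=
  Subgroup.closure {genA p, genB e}

/-- The tuple of differences `d_i - d_{i+1}` of neighbouring entries of `d`. -/
def diff {F : Type} [Sub F] {n : ℕ} (d : Fin n → F) : Fin (n - 1) → F :=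
  fun i => d ⟨i, by omega⟩ - d ⟨i + 1, by omega⟩

/-- A tuple is constant if all its entries agree. -/
def IsConst {F : Type} {n : ℕ} (d : Fin n → F) : Prop := ∀ i j, d i = d j

/-- A tuple is symmetric if its `i`-th entry is equal to its `i`-th-to-last entry. -/
def IsSymm {F : Type} {n : ℕ} (d : Fin n → F) : Prop := ∀ i, d i = d i.rev

open Classical in
/-- `con d` is `1` if `d` is constant and `0` otherwise. -/
noncomputable def con {F : Type} {n : ℕ} (d : Fin n → F) : ℕ := if IsConst d then 1 else 0

open Classical in
/-- `sym d` is `1` if `d` is symmetric and `0` otherwise. -/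
noncomputable def sym {F : Type} {n : ℕ} (d : Fin n → F) : ℕ := if IsSymm d then 1 else 0

end Groups

/-! ## The quotient `G' / γ₃(G)` as an `𝔽_p`-vector space -/

section Quotient

open scoped commutatorElement

variable {A : Type*} [Group A]

/-- The derived subgroup `G' = [G, G]`. -/
def der (G : Subgroup A) : Subgroup A := ⁅G, G⁆

/-- The third term `γ₃(G) = [[G, G], G]` of the lower central series. -/
def gamma3 (G : Subgroup A) : Subgroup A := ⁅⁅G, G⁆, G⁆

theorem der_le (G : Subgroup A) : der G ≤ G :=
  Subgroup.commutator_le.2 fun _ hg _ hh =>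
    G.mul_mem (G.mul_mem (G.mul_mem hg hh) (G.inv_mem hg)) (G.inv_mem hh)

instance gamma3_normal (G : Subgroup A) : ((gamma3 G).subgroupOf (der G)).Normal where
  conj_mem := by
    rintro ⟨n, hn'⟩ hn ⟨g, hg⟩
    rw [Subgroup.mem_subgroupOf] at hn ⊢
    change g * n * g⁻¹ ∈ gamma3 G
    have h : ⁅g, n⁆ ∈ gamma3 G := Subgroup.commutator_mem_commutator hg (der_le G hn')
    have h2 : g * n * g⁻¹ = ⁅g, n⁆ * n := by simp [commutatorElement_def]
    rw [h2]
    exact (gamma3 G).mul_mem h hn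

/-- The quotient `G' / γ₃(G)`, written additively. -/
def DerQuot (G : Subgroup A) : Type _ := Additive (der G ⧸ (gamma3 G).subgroupOf (der G))

/-- The class of an element of `G'` in `G' / γ₃(G)`. -/
def toDerQuot (G : Subgroup A) (g : der G) : DerQuot G :=
  Additive.ofMul (QuotientGroup.mk g)

instance (G : Subgroup A) : AddCommGroup (DerQuot G) :=
  { (inferInstance : AddGroup (Additive (der G ⧸ (gamma3 G).subgroupOf (der G)))) with
    add_comm := by
      rintro ⟨x⟩ ⟨y⟩
      change Additive.ofMul (QuotientGroup.mk (x * y)) = Additive.ofMul (QuotientGroup.mk (y * x))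
      congr 1
      rw [QuotientGroup.eq, Subgroup.mem_subgroupOf]
      have h : ⁅(y : A)⁻¹, (x : A)⁻¹⁆ ∈ gamma3 G :=
        Subgroup.commutator_mem_commutator ((der G).inv_mem y.2) (der_le G ((der G).inv_mem x.2))
      convert h using 1
      simp [commutatorElement_def, mul_assoc] }

theorem toDerQuot_mul (G : Subgroup A) (g h : der G) :
    toDerQuot G (g * h) = toDerQuot G g + toDerQuot G h := rfl

theorem toDerQuot_eq (G : Subgroup A) (g h : der G) :
    toDerQuot G g = toDerQuot G h ↔ (g : A)⁻¹ * h ∈ gamma3 G := by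
  change Additive.ofMul (QuotientGroup.mk g) = Additive.ofMul (QuotientGroup.mk h) ↔ _
  rw [Additive.ofMul.apply_eq_iff_eq, QuotientGroup.eq, Subgroup.mem_subgroupOf]
  rfl

theorem comm_mem {G : Subgroup A} {x y : A} (hx : x ∈ G) (hy : y ∈ G) : ⁅x, y⁆ ∈ der G :=
  Subgroup.commutator_mem_commutator hx hy

theorem toDerQuot_conj (G : Subgroup A) {x : A} (hx : x ∈ G) {g : A} (hg : g ∈ der G)
    (h : x * g * x⁻¹ ∈ der G) : toDerQuot G ⟨x * g * x⁻¹, h⟩ = toDerQuot G ⟨g, hg⟩ := by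
  rw [toDerQuot_eq]
  have h2 : ⁅g⁻¹, x⁆⁻¹ ∈ gamma3 G :=
    (gamma3 G).inv_mem (Subgroup.commutator_mem_commutator ((der G).inv_mem hg) hx)
  convert h2 using 1
  simp [commutatorElement_def, mul_assoc]

theorem toDerQuot_comm_mul (G : Subgroup A) {x y z : A} (hx : x ∈ G) (hy : y ∈ G) (hz : z ∈ G) :
    toDerQuot G ⟨⁅x, y * z⁆, comm_mem hx (G.mul_mem hy hz)⟩ =
      toDerQuot G ⟨⁅x, y⁆, comm_mem hx hy⟩ + toDerQuot G ⟨⁅x, z⁆, comm_mem hx hz⟩ := by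
  have e : ⁅x, y * z⁆ = ⁅x, y⁆ * (y * ⁅x, z⁆ * y⁻¹) := by simp [commutatorElement_def, mul_assoc]
  have hm : y * ⁅x, z⁆ * y⁻¹ ∈ der G := by
    have h1 := (der G).mul_mem ((der G).inv_mem (comm_mem hx hy)) (comm_mem hx (G.mul_mem hy hz))
    rwa [e, inv_mul_cancel_left] at h1
  rw [← toDerQuot_conj G hy (comm_mem hx hz) hm, ← toDerQuot_mul]
  congr 1
  exact Subtype.ext e

theorem toDerQuot_comm_swap (G : Subgroup A) {x y : A} (hx : x ∈ G) (hy : y ∈ G) :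
    toDerQuot G ⟨⁅x, y⁆, comm_mem hx hy⟩ = - toDerQuot G ⟨⁅y, x⁆, comm_mem hy hx⟩ := by
  rw [eq_neg_iff_add_eq_zero, ← toDerQuot_mul]
  have : (⟨⁅x, y⁆, comm_mem hx hy⟩ * ⟨⁅y, x⁆, comm_mem hy hx⟩ : der G) = 1 := by
    apply Subtype.ext; simp [commutatorElement_def, mul_assoc]
  rw [this]; rfl

/-- If `G` is generated by elements of order dividing `n`, then `G' / γ₃(G)` has exponent
dividing `n`. -/
theorem nsmul_derQuot (S : Set A) (n : ℕ) (hS : ∀ s ∈ S, s ^ n = 1)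
    (v : DerQuot (Subgroup.closure S)) : n • v = 0 := by
  let G := Subgroup.closure S
  have key : ∀ x (hx : x ∈ Subgroup.closure S), ∀ y (hy : y ∈ Subgroup.closure S),
      n • toDerQuot G ⟨⁅x, y⁆, comm_mem hx hy⟩ = 0 := by
    intro x hx y hy
    have hone : toDerQuot G ⟨⁅x, 1⁆, comm_mem hx G.one_mem⟩ = 0 := by
      have : (⟨⁅x, 1⁆, comm_mem hx G.one_mem⟩ : der G) = 1 := by
        apply Subtype.ext; simp
      rw [this]; rfl
    induction hy using Subgroup.closure_induction with
    | mem s hs =>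
      have hs' : s ∈ G := Subgroup.subset_closure hs
      have hpow : ∀ k : ℕ, toDerQuot G ⟨⁅x, s ^ k⁆, comm_mem hx (G.pow_mem hs' k)⟩ =
          k • toDerQuot G ⟨⁅x, s⁆, comm_mem hx hs'⟩ := by
        intro k
        induction k with
        | zero => simpa using hone
        | succ k ih =>
          rw [succ_nsmul, ← ih, ← toDerQuot_comm_mul G hx (G.pow_mem hs' k) hs']
          simp only [pow_succ]
      rw [← hpow n, ← hone]
      simp only [hS s hs]
    | one => rw [hone, smul_zero]
    | mul y z hy hz ihy ihz => rw [toDerQuot_comm_mul G hx hy hz, smul_add, ihy, ihz, add_zero]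
    | inv y hy ih =>
      have h := toDerQuot_comm_mul G hx hy (G.inv_mem hy)
      simp only [mul_inv_cancel, hone] at h
      have h2 := congrArg (fun t => n • t) h
      simp only [smul_zero, smul_add, ih, zero_add] at h2
      exact h2.symm
  obtain ⟨w⟩ := v
  obtain ⟨g, hg⟩ := w
  change n • toDerQuot (Subgroup.closure S) ⟨g, hg⟩ = 0
  have hg' : g ∈ Subgroup.closure {g | ∃ g₁ ∈ G, ∃ g₂ ∈ G, ⁅g₁, g₂⁆ = g} := hg
  induction hg' using Subgroup.closure_induction with
  | mem s hs =>
    obtain ⟨x, hx, y, hy, rfl⟩ := hs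
    exact key x hx y hy
  | one => exact smul_zero n
  | mul y z hy hz ihy ihz =>
    have := toDerQuot_mul G ⟨y, hy⟩ ⟨z, hz⟩
    change toDerQuot G ⟨y * z, _⟩ = _ at this
    rw [this, smul_add, ihy hy, ihz hz, add_zero]
  | inv y hy ih =>
    have := toDerQuot_mul (Subgroup.closure S) ⟨y, hy⟩ ⟨y⁻¹, hg⟩
    have h0 : (⟨y, hy⟩ * ⟨y⁻¹, hg⟩ : der (Subgroup.closure S)) = 1 := by apply Subtype.ext; simp
    rw [h0] at this
    have h2 := congrArg (fun t => n • t) this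
    simp only [smul_add, ih hy, zero_add] at h2
    rw [← h2]
    exact smul_zero n

variable {p : ℕ}

theorem genA_pow (p : ℕ) : genA p ^ p = 1 := by
  have h : ∀ n : ℕ, genA p ^ n = rooted (finRotate p ^ n) := by
    intro n
    induction n with
    | zero => ext1 v; cases v <;> rfl
    | succ n ih => rw [pow_succ, ih]; ext1 v; cases v <;> rfl
  rw [h]
  have : finRotate p ^ p = 1 := by
    rcases p with _ | _ | p
    · rfl
    · exact Equiv.ext fun x => Subsingleton.elim (α := Fin 1) _ _
    · have h1 := pow_orderOf_eq_one (finRotate (p + 2))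
      rwa [(isCycle_finRotate (n := p)).orderOf, support_finRotate, Finset.card_univ,
        Fintype.card_fin] at h1
  rw [this]; ext1 v; cases v <;> rfl

theorem genB_pow (e : Fin (p - 1) → ZMod p) : genB e ^ p = 1 := by
  have h1 : ∀ (n : ℕ) (x : Fin p) (v : List (Fin p)), (x : ℕ) = 0 →
      (genB e ^ n) (x :: v) = x :: (genB e ^ n) v := by
    intro n x v h
    induction n with
    | zero => rfl
    | succ n ih =>
      rw [pow_succ', RelIso.mul_apply, ih, RelIso.mul_apply]
      change dirFun e _ = _
      rw [dirFun, dif_pos h]; rfl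
  have h2 : ∀ (n : ℕ) (x : Fin p) (v : List (Fin p)) (h : (x : ℕ) ≠ 0),
      (genB e ^ n) (x :: v) = x :: ((genA p ^ (e ⟨x - 1, by omega⟩).val) ^ n) v := by
    intro n x v h
    induction n with
    | zero => rfl
    | succ n ih =>
      rw [pow_succ', RelIso.mul_apply, ih, pow_succ' (genA p ^ _), RelIso.mul_apply]
      change dirFun e _ = _
      rw [dirFun, dif_neg h]
  ext1 v
  induction v with
  | nil => exact map_nil _
  | cons x v ih =>
    by_cases h : (x : ℕ) = 0
    · rw [h1 _ _ _ h, ih]; rfl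
    · rw [h2 _ _ _ h, ← pow_mul, mul_comm, pow_mul, genA_pow, one_pow]; rfl

/-- For a GGS-group `G`, the quotient `G' / γ₃(G)` is an `𝔽_p`-vector space. -/
instance (e : Fin (p - 1) → ZMod p) : Module (ZMod p) (DerQuot (ggs e)) :=
  AddCommGroup.zmodModule (nsmul_derQuot _ p (by
    rintro s (rfl | rfl)
    · exact genA_pow p
    · exact genB_pow e))

end Quotient

/-! ## Circulant spaces -/

section Circulant

variable (F : Type*) {K : Type*} [Ring F] [AddCommGroup K] [Module F K] {n : ℕ}

/-- The linear map `C` of `V = K^n` that cyclically permutes the coordinates, moving the entry in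
position `x` to position `x + 1` (modulo `n`). For one-dimensional `K` it permutes cyclically the
basis of `V` that consists of the tuples with the entry `c` in one position and `0` in the others,
where `c` spans `K`. -/
def shift : (Fin n → K) →ₗ[F] (Fin n → K) := LinearMap.funLeft F K (finRotate n).symm

/-- The circulant space `Circ(M)`: the smallest `C`-invariant subspace containing `M`. -/
def circ (M : Set (Fin n → K)) : Submodule F (Fin n → K) :=
  sInf {W | M ⊆ W ∧ ∀ v ∈ W, shift F v ∈ W}

/-- `Circ_i(V)`: the set of the vectors `v` whose circulant space has dimension at most `i`. -/
def circLE (i : ℕ) : Set (Fin n → K) := {v | Module.finrank F (circ F {v}) ≤ i}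

end Circulant

end GGS

/-! Index coordinates by residues modulo p and extend e by l 0 = 0 to a function l on `ZMod p`. The
conjugate of b by a^i has section b at i and a^{l(k-i)} at every other k. Let S and D be the groups
of first-level section tuples of Stab_G(1) and of G'. As G' fixes the first level, ψ(G'') = [D, D];
moreover D is generated by the S-conjugates of the quotients of cyclically neighbouring tuples
(`derSections_le_closure`). Two facts about [D, D] give the theorem.

The first is that [D, D] contains γ₃(G) × ⋯ × γ₃(G) (`gamma3_le_rist_D`), so that it is the full
preimage of its image in V. The same is shown for [S, S] beforehand (`gamma3_le_rist_S`): the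
commutator of two conjugates of b lives on two coordinates, and commuting it with an element of S
that is trivial on one of them isolates the other. Such elements exist unless l is a geometric
progression, a case in which another commutator isolates a coordinate. The step from S to D splits
according to whether l is even.

The second is the shape of the image (`mem_image_D_iff`). Since G'/γ₃(G) is spanned by the class of
[a, b], the kernel of C - 1 on V is at most a line, and C - 1 is nilpotent with (C - 1)^p = 0. Hence
the C-invariant subspaces are the kernels of the powers of C - 1, and Circ_m(V) is the kernel of (C
- 1)^m (`mem_circLE_iff`). Only the exponent is to be found. The kernel of (C - 1)^(p-1) is given by
vanishing coordinate sum, that of (C - 1)^(p-2) by vanishing sum and first moment ∑ k v_k.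
Commutator classes are determinants in the exponents of a and b, so sums and moments of the
generators of the image can be computed: all sums vanish exactly when e'' is symmetric, and then all
moments vanish exactly when e' is constant. In that last case an explicit second difference,
non-zero because e is not constant, shows that the image is no smaller. -/

namespace GGS

/-! ## Circulant spaces and nilpotent endomorphisms -/

section Nilpotent

variable {F V : Type*} [Field F] [AddCommGroup V] [Module F V]

/-- If the kernel of `N` is at most one-dimensional, an invariant subspace that contains a vector
of exact order `r + 1` contains all vectors of order at most `r + 1`. -/
theorem ker_pow_le_of_mem (N : V →ₗ[F] V) (hN : ∀ x y, N x = 0 → x ≠ 0 → N y = 0 → ∃ t : F, y = t • x)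
    (T : Submodule F V) (hT : ∀ v ∈ T, N v ∈ T) (r : ℕ) :
    ∀ f ∈ T, (N ^ (r + 1)) f = 0 → (N ^ r) f ≠ 0 → ∀ g, (N ^ (r + 1)) g = 0 → g ∈ T := by
  induction r with
  | zero =>
    intro f hf h1 h0 g hg
    obtain ⟨t, rfl⟩ := hN f g (by simpa using h1) (by simpa using h0) (by simpa using hg)
    exact T.smul_mem _ hf
  | succ r ih =>
    intro f hf h1 h0 g hg
    have hs : ∀ n v, (N ^ n) (N v) = (N ^ (n + 1)) v := fun n v => by rw [pow_succ]; rfl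
    have hs' : ∀ n v, N ((N ^ n) v) = (N ^ (n + 1)) v := fun n v => by rw [pow_succ']; rfl
    have key := ih (N f) (hT f hf) (by rw [hs, h1]) (by rwa [hs])
    -- Both top iterates lie in the kernel, which is a line, so subtracting a multiple of f from g
    -- lowers its order.
    obtain ⟨t, ht⟩ := hN _ ((N ^ (r + 1)) g) (by rw [hs', h1]) h0 (by rw [hs', hg])
    have : g - t • f ∈ T := key _ (by rw [map_sub, map_smul, ht, sub_self])
    simpa using T.add_mem this (T.smul_mem t hf)

/-- A subspace on which `N ^ m` does not vanish has dimension greater than `m`, if `N` is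
nilpotent and preserves the subspace. -/
theorem lt_finrank_of_pow_ne_zero [FiniteDimensional F V] (N : V →ₗ[F] V) (hN : IsNilpotent N) (m : ℕ) :
    ∀ (T : Submodule F V), (∀ v ∈ T, N v ∈ T) → (∃ v ∈ T, (N ^ m) v ≠ 0) →
      m < Module.finrank F T := by
  induction m with
  | zero =>
    rintro T - ⟨v, hv, h0⟩
    have : T ≠ ⊥ := fun h => h0 (by rw [h] at hv; simpa using hv)
    exact Nat.pos_of_ne_zero fun h => this (Submodule.finrank_eq_zero.1 h)
  | succ m ih =>
    rintro T hT ⟨v, hv, h0⟩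
    have hle : T.map N ≤ T := by
      rintro _ ⟨w, hw, rfl⟩
      exact hT w hw
    have h1 : m < Module.finrank F (T.map N) :=
      ih _ (by rintro _ ⟨w, hw, rfl⟩; exact ⟨_, hT w hw, rfl⟩)
        ⟨N v, ⟨v, hv, rfl⟩, by rwa [← Module.End.mul_apply, ← pow_succ]⟩
    -- If N mapped T onto itself, every power of N would too, and nilpotency would force T = 0.
    have hlt : T.map N < T := by
      refine lt_of_le_of_ne hle fun h => ?_
      obtain ⟨n, hn⟩ := hN
      have hall : ∀ k, ∀ w ∈ T, ∃ u ∈ T, w = (N ^ k) u := by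
        intro k
        induction k with
        | zero => exact fun w hw => ⟨w, hw, rfl⟩
        | succ k ihk =>
          intro w hw
          obtain ⟨u, hu, rfl⟩ := ihk w hw
          rw [← h] at hu
          obtain ⟨u', hu', rfl⟩ := hu
          exact ⟨u', hu', by rw [pow_succ]; rfl⟩
      obtain ⟨u, -, rfl⟩ := hall n v hv
      rw [hn] at h0
      simp at h0
    have := Submodule.finrank_lt_finrank_of_lt hlt
    omega

end Nilpotent

section Circ

variable {F K : Type*} [Field F] [AddCommGroup K] [Module F K] {n : ℕ}

theorem mem_circ (v : Fin n → K) : v ∈ circ F {v} := by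
  rw [circ, Submodule.mem_sInf]
  exact fun W hW => hW.1 rfl

theorem shift_mem_circ (v w : Fin n → K) (hw : w ∈ circ F {v}) : shift F w ∈ circ F {v} := by
  rw [circ, Submodule.mem_sInf] at hw ⊢
  exact fun W hW => hW.2 _ (hw W hW)

/-- A vector lies in `circLE m` if and only if it is annihilated by `(C - 1) ^ m`. -/
theorem mem_circLE_iff [FiniteDimensional F K] (hnil : IsNilpotent (shift F (K := K) (n := n) - 1)) (m : ℕ)
    (v : Fin n → K) : v ∈ circLE F m ↔
      ((shift F - 1 : (Fin n → K) →ₗ[F] (Fin n → K)) ^ m) v = 0 := by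
  set N : (Fin n → K) →ₗ[F] (Fin n → K) := shift F - 1 with hN
  have hNv : ∀ w, N w = shift F w - w := fun w => rfl
  constructor
  · intro h
    by_contra h0
    have := lt_finrank_of_pow_ne_zero N hnil m (circ F {v})
      (fun w hw => by rw [hNv]; exact Submodule.sub_mem _ (shift_mem_circ v w hw) hw)
      ⟨v, mem_circ v, h0⟩
    exact absurd h (not_le.2 this)
  · intro h
    -- The first m iterates of v span an invariant subspace, because all later iterates vanish.
    let W : Submodule F (Fin n → K) := Submodule.span F (Set.range fun i : Fin m => (N ^ (i : ℕ)) v)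
    have hW : ∀ i, (N ^ i) v ∈ W := by
      intro i
      by_cases hi : i < m
      · exact Submodule.subset_span ⟨⟨i, hi⟩, rfl⟩
      · obtain ⟨j, rfl⟩ := Nat.exists_eq_add_of_le (not_lt.1 hi)
        rw [add_comm, pow_add, Module.End.mul_apply, h, map_zero]
        exact W.zero_mem
    have hle : circ F {v} ≤ W := by
      refine sInf_le ⟨Set.singleton_subset_iff.2 (hW 0), fun w hw => ?_⟩
      have hw' : N w ∈ W := by
        induction hw using Submodule.span_induction with
        | mem x hx =>
          obtain ⟨i, rfl⟩ := hx
          change N ((N ^ (i : ℕ)) v) ∈ W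
          rw [← Module.End.mul_apply, ← pow_succ']
          exact hW _
        | zero => rw [map_zero]; exact W.zero_mem
        | add x y _ _ hx hy => rw [map_add]; exact W.add_mem hx hy
        | smul t x _ hx => rw [map_smul]; exact W.smul_mem _ hx
      have := W.add_mem hw' hw
      rwa [hNv, sub_add_cancel] at this
    refine (Submodule.finrank_mono hle).trans ((finrank_range_le_card _).trans ?_)
    simp

end Circ

/-! ## The cyclic shift of functions on `ZMod p` -/

section CyclicShift

variable {p : ℕ} [Fact p.Prime] {K : Type*} [AddCommGroup K] [Module (ZMod p) K]

/-- The cyclic shift of functions on `ZMod p`. -/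
def cycShift (p : ℕ) (K : Type*) [AddCommGroup K] [Module (ZMod p) K] :
    (ZMod p → K) →ₗ[ZMod p] (ZMod p → K) :=
  LinearMap.funLeft (ZMod p) K fun k => k - 1

/-- The difference operator `C - 1`. -/
def cycDiff (p : ℕ) (K : Type*) [AddCommGroup K] [Module (ZMod p) K] :
    (ZMod p → K) →ₗ[ZMod p] (ZMod p → K) :=
  cycShift p K - 1

@[simp] theorem cycShift_apply (v : ZMod p → K) (k : ZMod p) : cycShift p K v k = v (k - 1) := rfl

@[simp] theorem cycDiff_apply (v : ZMod p → K) (k : ZMod p) :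
    cycDiff p K v k = v (k - 1) - v k := rfl

theorem eq_of_forall_sub_one {X : Type*} (f : ZMod p → X) (h : ∀ k, f (k - 1) = f k) (k : ZMod p) :
    f k = f 0 := by
  have : ∀ n : ℕ, f (n : ZMod p) = f 0 := by
    intro n
    induction n with
    | zero => simp
    | succ n ih => rw [← ih, ← h]; simp
  rw [← ZMod.natCast_zmod_val k, this]

theorem eq_const_of_cycDiff_eq_zero {v : ZMod p → K} (h : cycDiff p K v = 0) (k : ZMod p) :
    v k = v 0 :=
  eq_of_forall_sub_one v (fun k => sub_eq_zero.1 (congrFun h k)) k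

theorem cycShift_pow_apply (n : ℕ) (v : ZMod p → K) (k : ZMod p) :
    (cycShift p K ^ n) v k = v (k - n) := by
  induction n generalizing k with
  | zero => simp
  | succ n ih => rw [pow_succ', Module.End.mul_apply, cycShift_apply, ih]; congr 1; push_cast; ring

theorem sum_sub_right {K : Type*} [AddCommMonoid K] (f : ZMod p → K) (c : ZMod p) : ∑ k, f (k - c) = ∑ k, f k :=
  (Equiv.subRight c).sum_comp f

/-- In characteristic p, (X - 1)^p = X^p - 1, and cancelling X - 1 gives (X - 1)^(p-1) = 1 + X + ⋯ +
X^(p-1), which is evaluated at the shift. -/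
theorem cycDiff_pow_sub_one (v : ZMod p → K) (k : ZMod p) :
    (cycDiff p K ^ (p - 1)) v k = ∑ j, v j := by
  have hp : p.Prime := Fact.out
  have hpoly : ((Polynomial.X - 1) ^ (p - 1) : Polynomial (ZMod p)) =
      ∑ i ∈ Finset.range p, Polynomial.X ^ i := by
    have h1 : ((Polynomial.X - 1 : Polynomial (ZMod p))) ≠ 0 := by
      simpa using Polynomial.X_sub_C_ne_zero (1 : ZMod p)
    refine mul_right_cancel₀ h1 ?_
    rw [← pow_succ, Nat.sub_add_cancel hp.one_le, geom_sum_mul, sub_pow_char, one_pow]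
  have h2 := congrArg (Polynomial.aeval (cycShift p K)) hpoly
  simp only [map_pow, map_sub, Polynomial.aeval_X, map_one, map_sum] at h2
  rw [cycDiff, h2, LinearMap.sum_apply, Finset.sum_apply]
  simp only [cycShift_pow_apply]
  rw [← Finset.sum_nbij' (s := Finset.univ) (f := fun j : ZMod p => v (k - j))
    (fun j : ZMod p => j.val) (fun n => (n : ZMod p))]
  · exact (Equiv.subLeft k).sum_comp v
  · exact fun j _ => Finset.mem_range.2 (ZMod.val_lt j)
  · exact fun _ _ => Finset.mem_univ _
  · exact fun j _ => ZMod.natCast_zmod_val j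
  · exact fun n hn => ZMod.val_cast_of_lt (Finset.mem_range.1 hn)
  · intro j _; simp

theorem sum_cycDiff (v : ZMod p → K) : ∑ k, cycDiff p K v k = 0 := by
  simp [Finset.sum_sub_distrib, sum_sub_right]

/-- Summation by parts; the weight k is itself a residue class, so going around the cycle leaves no
boundary term. -/
theorem sum_smul_cycDiff (v : ZMod p → K) : ∑ k : ZMod p, k • cycDiff p K v k = ∑ k, v k := by
  have h : ∀ k : ZMod p, k • cycDiff p K v k =
      (fun j : ZMod p => j • v j) (k - 1) + v (k - 1) - k • v k := by
    intro k
    simp only [cycDiff_apply, smul_sub, sub_smul, one_smul]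
    abel
  simp only [h, Finset.sum_sub_distrib, Finset.sum_add_distrib]
  rw [sum_sub_right (fun j : ZMod p => j • v j), sum_sub_right]
  abel

theorem cycDiff_pow_eq_zero (v : ZMod p → K) : (cycDiff p K ^ p) v = 0 := by
  have hp : p.Prime := Fact.out
  obtain ⟨q, hq⟩ : ∃ q, p = q + 1 := ⟨p - 1, (Nat.sub_add_cancel hp.one_le).symm⟩
  have h := cycDiff_pow_sub_one v
  have h2 : (cycDiff p K ^ (q + 1)) v = 0 := by
    rw [pow_succ', Module.End.mul_apply]
    funext k
    have hq' : q = p - 1 := by omega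
    simp only [hq', cycDiff_apply, h, sub_self, Pi.zero_apply]
  rwa [← hq] at h2

/-- Negated partial sums are an antidifference; the hypothesis is what makes them close up at k = 0.
-/
theorem exists_cycDiff_eq {v : ZMod p → K} (h : ∑ k, v k = 0) : ∃ w, cycDiff p K w = v := by
  refine ⟨fun k => - ∑ j ∈ Finset.range (k.val + 1), v j, ?_⟩
  have hp : p.Prime := Fact.out
  funext k
  by_cases hk : k = 0
  · subst hk
    have h1 : ((0 : ZMod p) - 1).val + 1 = p := by
      obtain ⟨q, hq⟩ : ∃ q, p = q + 1 := ⟨p - 1, (Nat.sub_add_cancel hp.one_le).symm⟩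
      subst hq
      rw [zero_sub, ZMod.val_neg_one]
    have h2 : ∑ j ∈ Finset.range p, v (j : ZMod p) = 0 := by
      rw [← h]
      refine Finset.sum_nbij' (fun n => (n : ZMod p)) (fun j : ZMod p => j.val) ?_ ?_ ?_ ?_ ?_
      · exact fun _ _ => Finset.mem_univ _
      · exact fun j _ => Finset.mem_range.2 (ZMod.val_lt j)
      · exact fun n hn => ZMod.val_cast_of_lt (Finset.mem_range.1 hn)
      · exact fun j _ => ZMod.natCast_zmod_val j
      · exact fun _ _ => rfl
    rw [cycDiff_apply, h1, h2]
    simp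
  · have h1 : (k - 1).val + 1 = k.val := by
      have : k.val ≠ 0 := fun h => hk ((ZMod.val_eq_zero k).1 h)
      have h2 : (k - 1).val = k.val - 1 := by
        have := ZMod.val_sub (a := k) (b := 1) (by rw [ZMod.val_one]; omega)
        rwa [ZMod.val_one] at this
      omega
    rw [cycDiff_apply, h1, Finset.sum_range_succ _ k.val, ZMod.natCast_zmod_val]
    abel

theorem cycDiff_pow_sub_one_eq_zero_iff (v : ZMod p → K) :
    (cycDiff p K ^ (p - 1)) v = 0 ↔ ∑ k, v k = 0 := by
  constructor
  · intro h; rw [← cycDiff_pow_sub_one v 0, h]; rfl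
  · intro h; funext k; rw [cycDiff_pow_sub_one, h]; rfl

/-- A vector with sum zero is a difference of some w, and its first moment is the sum of w; this
reduces the exponent p - 2 to p - 1. -/
theorem cycDiff_pow_sub_two_eq_zero_iff (v : ZMod p → K) :
    (cycDiff p K ^ (p - 2)) v = 0 ↔ ∑ k, v k = 0 ∧ ∑ k : ZMod p, k • v k = 0 := by
  have hp : 2 ≤ p := (Fact.out : p.Prime).two_le
  have hs : ∀ w : ZMod p → K, (cycDiff p K ^ (p - 2)) (cycDiff p K w) = (cycDiff p K ^ (p - 1)) w := by
    intro w
    rw [← Module.End.mul_apply, ← pow_succ]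
    congr 2; omega
  have h0 : (cycDiff p K ^ (p - 2)) v = 0 → ∑ k, v k = 0 := by
    intro h
    rw [← cycDiff_pow_sub_one_eq_zero_iff, ← hs, ← Module.End.mul_apply, ← pow_succ, pow_succ',
      Module.End.mul_apply, h, map_zero]
  refine ⟨fun h => ⟨h0 h, ?_⟩, fun ⟨h, h1⟩ => ?_⟩
  · obtain ⟨w, rfl⟩ := exists_cycDiff_eq (h0 h)
    rw [hs, cycDiff_pow_sub_one_eq_zero_iff] at h
    rw [sum_smul_cycDiff, h]
  · obtain ⟨w, rfl⟩ := exists_cycDiff_eq h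
    rw [sum_smul_cycDiff] at h1
    rw [hs, cycDiff_pow_sub_one_eq_zero_iff, h1]

theorem exists_smul_of_cycDiff_eq_zero {c : K} (hc : ∀ x : K, ∃ t : ZMod p, x = t • c)
    (x y : ZMod p → K) (hx : cycDiff p K x = 0) (hx0 : x ≠ 0)
    (hy : cycDiff p K y = 0) : ∃ t : ZMod p, y = t • x := by
  have hx' := eq_const_of_cycDiff_eq_zero hx
  have hy' := eq_const_of_cycDiff_eq_zero hy
  obtain ⟨s, hs⟩ := hc (x 0)
  obtain ⟨t, ht⟩ := hc (y 0)
  have hs0 : s ≠ 0 := by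
    rintro rfl
    exact hx0 (funext fun k => by rw [hx', hs, zero_smul]; rfl)
  refine ⟨t * s⁻¹, funext fun k => ?_⟩
  rw [Pi.smul_apply, hx', hy', hs, ht, smul_smul, mul_assoc, inv_mul_cancel₀ hs0, mul_one]

/-! ### Invariant subspaces of the cyclic shift -/

section Invariant

variable {c : K} {T : Submodule (ZMod p) (ZMod p → K)}

theorem mem_of_cycDiff_pow (hc : ∀ x : K, ∃ t : ZMod p, x = t • c)
    (hT : ∀ v ∈ T, cycShift p K v ∈ T) (r : ℕ) {f : ZMod p → K} (hf : f ∈ T)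
    (h1 : (cycDiff p K ^ (r + 1)) f = 0) (h0 : (cycDiff p K ^ r) f ≠ 0) {g : ZMod p → K}
    (hg : (cycDiff p K ^ (r + 1)) g = 0) : g ∈ T :=
  ker_pow_le_of_mem (cycDiff p K) (exists_smul_of_cycDiff_eq_zero hc) T
    (fun v hv => T.sub_mem (hT v hv) hv) r f hf h1 h0 g hg

/-- An invariant subspace that contains a vector with non-zero sum is everything. -/
theorem mem_of_sum_ne_zero (hc : ∀ x : K, ∃ t : ZMod p, x = t • c)
    (hT : ∀ v ∈ T, cycShift p K v ∈ T) {f : ZMod p → K} (hf : f ∈ T) (h : ∑ k, f k ≠ 0)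
    (g : ZMod p → K) : g ∈ T := by
  have hp : p - 1 + 1 = p := Nat.sub_add_cancel (Fact.out : p.Prime).one_le
  refine mem_of_cycDiff_pow hc hT (p - 1) hf ?_ ?_ ?_
  · rw [hp, cycDiff_pow_eq_zero]
  · rwa [Ne, cycDiff_pow_sub_one_eq_zero_iff]
  · rw [hp, cycDiff_pow_eq_zero]

/-- An invariant subspace that contains a vector with sum zero and non-zero first moment contains
all vectors with sum zero. -/
theorem mem_of_moment_ne_zero (hc : ∀ x : K, ∃ t : ZMod p, x = t • c)
    (hT : ∀ v ∈ T, cycShift p K v ∈ T) {f : ZMod p → K} (hf : f ∈ T) (h0 : ∑ k, f k = 0)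
    (h : ∑ k : ZMod p, k • f k ≠ 0) {g : ZMod p → K} (hg : ∑ k, g k = 0) : g ∈ T := by
  have hp : p - 2 + 1 = p - 1 := by have := (Fact.out : p.Prime).two_le; omega
  refine mem_of_cycDiff_pow hc hT (p - 2) hf ?_ ?_ ?_
  · rwa [hp, cycDiff_pow_sub_one_eq_zero_iff]
  · rw [Ne, cycDiff_pow_sub_two_eq_zero_iff]; exact fun h' => h h'.2
  · rwa [hp, cycDiff_pow_sub_one_eq_zero_iff]

/-- An invariant subspace that contains a non-zero second difference of a vector supported at one
point contains all vectors with vanishing sum and first moment. -/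
theorem mem_of_second_diff_mem (hp : p ≠ 2) (hc : ∀ x : K, ∃ t : ZMod p, x = t • c)
    (hT : ∀ v ∈ T, cycShift p K v ∈ T) {f : ZMod p → K} (hf : cycDiff p K (cycDiff p K f) ∈ T)
    (h : ∑ k, f k ≠ 0) {g : ZMod p → K} (hg : ∑ k, g k = 0) (hg' : ∑ k : ZMod p, k • g k = 0) :
    g ∈ T := by
  have h2 : 2 ≤ p := (Fact.out : p.Prime).two_le
  have hp' : p - 3 + 1 = p - 2 := by omega
  refine mem_of_cycDiff_pow hc hT (p - 3) hf ?_ ?_ ?_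
  · rw [hp', cycDiff_pow_sub_two_eq_zero_iff, sum_smul_cycDiff]
    exact ⟨sum_cycDiff _, sum_cycDiff _⟩
  · rw [← Module.End.mul_apply, ← Module.End.mul_apply, mul_assoc, ← pow_two, ← pow_add]
    have : p - 3 + 2 = p - 1 := by omega
    rwa [this, Ne, cycDiff_pow_sub_one_eq_zero_iff]
  · rw [hp', cycDiff_pow_sub_two_eq_zero_iff]; exact ⟨hg, hg'⟩

end Invariant

end CyclicShift

/-! ## The defining tuple as a function on `ZMod p` -/

section Tuple

variable {p : ℕ}

/-- The differences `l k - l (k - 1)` of neighbouring values. -/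
def step (l : ZMod p → ZMod p) (k : ZMod p) : ZMod p := l k - l (k - 1)

/-- The differences of the differences. -/
def step₂ (l : ZMod p → ZMod p) (k : ZMod p) : ZMod p := step l k - step l (k + 1)

variable [Fact p.Prime]

/-- The defining tuple, extended by `0` to a function on `ZMod p`. -/
def extend (e : Fin (p - 1) → ZMod p) (k : ZMod p) : ZMod p :=
  if h : k = 0 then 0 else e ⟨k.val - 1, by
    have := ZMod.val_lt k
    have : k.val ≠ 0 := fun h' => h ((ZMod.val_eq_zero k).1 h')
    omega⟩

@[simp] theorem extend_zero (e : Fin (p - 1) → ZMod p) : extend e 0 = 0 := dif_pos rfl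

theorem extend_natCast (e : Fin (p - 1) → ZMod p) (i : ℕ) (hi : i < p - 1) :
    extend e ((i + 1 : ℕ) : ZMod p) = e ⟨i, hi⟩ := by
  have hv : ((i + 1 : ℕ) : ZMod p).val = i + 1 := ZMod.val_cast_of_lt (by omega)
  have h : ((i + 1 : ℕ) : ZMod p) ≠ 0 := by
    intro h; rw [h, ZMod.val_zero] at hv; omega
  rw [extend, dif_neg h]
  congr 1
  rw [Fin.mk.injEq, hv, Nat.add_sub_cancel]

/-- Fixes the index shift: the steps at 0 and 1 involve the artificial value at 0, so the genuine
differences of e sit at the residues 2, …, p - 1. -/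
theorem diff_eq_step (e : Fin (p - 1) → ZMod p) (i : Fin (p - 1 - 1)) :
    diff e i = - step (extend e) ((i + 2 : ℕ) : ZMod p) := by
  have h1 := extend_natCast e i (by omega)
  have h2 := extend_natCast e (i + 1) (by omega)
  have h3 : (((i : ℕ) + 2 : ℕ) : ZMod p) - 1 = ((i + 1 : ℕ) : ZMod p) := by push_cast; ring
  rw [step, h3, h1, show (i : ℕ) + 2 = i + 1 + 1 from rfl, h2, diff]
  ring

theorem exists_natCast_add_two {k : ZMod p} (h0 : k ≠ 0) (h1 : k ≠ 1) :
    ∃ i : ℕ, i < p - 1 - 1 ∧ k = ((i + 2 : ℕ) : ZMod p) := by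
  have hv := ZMod.val_lt k
  have h0' : k.val ≠ 0 := fun h => h0 ((ZMod.val_eq_zero k).1 h)
  have h1' : k.val ≠ 1 := fun h => h1 (by rw [← ZMod.natCast_zmod_val k, h, Nat.cast_one])
  refine ⟨k.val - 2, by omega, ?_⟩
  rw [Nat.sub_add_cancel (by omega), ZMod.natCast_zmod_val]

theorem natCast_ne_zero_of_lt {i : ℕ} (h0 : i ≠ 0) (h : i < p) : (i : ZMod p) ≠ 0 := by
  intro h'
  have := ZMod.val_cast_of_lt h
  rw [h', ZMod.val_zero] at this
  omega

theorem natCast_ne_one_of_lt {i : ℕ} (h0 : i ≠ 1) (h : i < p) : (i : ZMod p) ≠ 1 := by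
  intro h'
  have := ZMod.val_cast_of_lt h
  rw [h', ZMod.val_one] at this
  omega

theorem isConst_of_step_eq_zero (e : Fin (p - 1) → ZMod p)
    (h : ∀ k, k ≠ 0 → k ≠ 1 → step (extend e) k = 0) : IsConst e := by
  have hp : 2 ≤ p := (Fact.out : p.Prime).two_le
  have key : ∀ i (hi : i < p - 1), e ⟨i, hi⟩ = e ⟨0, by omega⟩ := by
    intro i
    induction i with
    | zero => intro _; rfl
    | succ i ih =>
      intro hi
      rw [← ih (by omega)]
      have h2 := h ((i + 2 : ℕ) : ZMod p) (natCast_ne_zero_of_lt (by omega) (by omega))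
        (natCast_ne_one_of_lt (by omega) (by omega))
      have h3 := diff_eq_step e ⟨i, by omega⟩
      rw [h2, neg_zero, diff, sub_eq_zero] at h3
      exact h3.symm
  exact fun i j => (key i i.2).trans (key j j.2).symm

theorem isConst_diff_iff (e : Fin (p - 1) → ZMod p) :
    IsConst (diff e) ↔ ∃ m, ∀ k, k ≠ 0 → k ≠ 1 → step (extend e) k = m := by
  constructor
  · intro h
    by_cases hp : 0 < p - 1 - 1
    · refine ⟨- diff e ⟨0, hp⟩, fun k h0 h1 => ?_⟩
      obtain ⟨i, hi, rfl⟩ := exists_natCast_add_two h0 h1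
      rw [← h ⟨i, hi⟩, diff_eq_step, neg_neg]
    · refine ⟨0, fun k h0 h1 => ?_⟩
      obtain ⟨i, hi, rfl⟩ := exists_natCast_add_two h0 h1
      omega
  · rintro ⟨m, hm⟩ i j
    rw [diff_eq_step, diff_eq_step,
      hm _ (natCast_ne_zero_of_lt (by omega) (by omega)) (natCast_ne_one_of_lt (by omega) (by omega)),
      hm _ (natCast_ne_zero_of_lt (by omega) (by omega)) (natCast_ne_one_of_lt (by omega) (by omega))]

theorem diff_diff_eq (e : Fin (p - 1) → ZMod p) (i : Fin (p - 1 - 1 - 1)) :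
    diff (diff e) i = - step₂ (extend e) ((i + 2 : ℕ) : ZMod p) := by
  rw [diff, diff_eq_step, diff_eq_step, step₂]
  have : (((i : ℕ) + 2 : ℕ) : ZMod p) + 1 = ((i + 1 + 2 : ℕ) : ZMod p) := by push_cast; ring
  rw [this]
  simp only
  ring

/-- `step₂` is a second difference up to sign, and second differences are orthogonal to linear
functions. -/
theorem sum_mul_step₂ (l : ZMod p → ZMod p) : ∑ k, k * step₂ l k = 0 := by
  have h : ∀ k, k * step₂ l k = (2 * (k * l k)) - ((k - 1) * l (k - 1) + l (k - 1)) -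
      (fun j => (j - 1) * l j) (k - -1) := by
    intro k
    simp only [step₂, step, add_sub_cancel_right, sub_neg_eq_add]
    ring
  simp only [h, Finset.sum_sub_distrib, Finset.sum_add_distrib]
  rw [sum_sub_right (fun j => (j - 1) * l j) (-1), sum_sub_right (fun k => k * l k) 1, sum_sub_right l 1]
  simp only [sub_mul, one_mul, Finset.sum_sub_distrib, ← Finset.mul_sum]
  ring

theorem one_ne_neg_one (hp : p ≠ 2) : (1 : ZMod p) ≠ -1 := by
  have : Fact (2 < p) := ⟨lt_of_le_of_ne (Fact.out : p.Prime).two_le hp.symm⟩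
  exact (ZMod.neg_one_ne_one).symm

theorem two_ne_zero' (hp : p ≠ 2) : (2 : ZMod p) ≠ 0 := by
  intro h
  apply one_ne_neg_one hp
  rw [← sub_eq_zero, sub_neg_eq_add, one_add_one_eq_two, h]

theorem isSymm_diff_diff_iff (hp : p ≠ 2) (e : Fin (p - 1) → ZMod p) :
    IsSymm (diff (diff e)) ↔ ∀ k, step₂ (extend e) k = step₂ (extend e) (-k) := by
  have hneg : ∀ i : Fin (p - 1 - 1 - 1),
      ((i.rev + 2 : ℕ) : ZMod p) = - ((i + 2 : ℕ) : ZMod p) := by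
    intro i
    rw [eq_neg_iff_add_eq_zero, ← Nat.cast_add, Fin.val_rev]
    have : p - 1 - 1 - 1 - (↑i + 1) + 2 + (↑i + 2) = p := by omega
    rw [this, ZMod.natCast_self]
  constructor
  · intro h
    have hmid : ∀ k, k ≠ 0 → k ≠ 1 → k ≠ -1 → step₂ (extend e) k = step₂ (extend e) (-k) := by
      intro k h0 h1 h2
      obtain ⟨i, hi, rfl⟩ := exists_natCast_add_two h0 h1
      have hi' : i < p - 1 - 1 - 1 := by
        refine lt_of_le_of_ne (by omega) fun hi' => h2 ?_
        rw [eq_neg_iff_add_eq_zero]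
        have : i + 2 + 1 = p := by omega
        have h3 : ((i + 2 + 1 : ℕ) : ZMod p) = 0 := by rw [this, ZMod.natCast_self]
        rw [← h3]; push_cast; ring
      have := h ⟨i, hi'⟩
      rw [diff_diff_eq, diff_diff_eq, hneg] at this
      exact neg_injective this
    -- The entries of e'' only reach the residues 2, …, p - 2. In the first moment of the odd part
    -- of `step₂`, which is zero, only the residues 1 and -1 survive, and they contribute twice the
    -- wanted difference.
    have hone : step₂ (extend e) 1 = step₂ (extend e) (-1) := by
      have h1 : ∑ k, k * (step₂ (extend e) k - step₂ (extend e) (-k)) = 0 := by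
        have h2 : ∑ k, k * step₂ (extend e) (-k) = 0 := by
          rw [← Equiv.sum_comp (Equiv.neg (ZMod p)) fun k => k * step₂ (extend e) (-k)]
          simp [sum_mul_step₂]
        simp only [mul_sub, Finset.sum_sub_distrib, h2, sum_mul_step₂, sub_zero]
      rw [Finset.sum_eq_add 1 (-1) (one_ne_neg_one hp)] at h1
      · rw [neg_neg] at h1
        have h2 : (2 : ZMod p) * (step₂ (extend e) 1 - step₂ (extend e) (-1)) = 0 := by linear_combination h1
        exact sub_eq_zero.1 ((mul_eq_zero.1 h2).resolve_left (two_ne_zero' hp))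
      · intro k _ hk
        by_cases h0 : k = 0
        · simp [h0]
        · rw [hmid k h0 hk.1 hk.2, sub_self, mul_zero]
      · simp
      · simp
    intro k
    by_cases h0 : k = 0
    · simp [h0]
    by_cases h1 : k = 1
    · rw [h1, hone]
    by_cases h2 : k = -1
    · rw [h2, neg_neg, hone]
    exact hmid k h0 h1 h2
  · intro h i
    rw [diff_diff_eq, diff_diff_eq, hneg, h]

/-- The steps add up to 0 around the cycle, and so do p copies of m; only the residues 0 and 1
remain. -/
theorem step_add_step {l : ZMod p → ZMod p} {m : ZMod p}
    (hm : ∀ k, k ≠ 0 → k ≠ 1 → step l k = m) : step l 0 + step l 1 = 2 * m := by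
  have h1 : ∑ k, (step l k - m) = 0 := by
    simp only [step, Finset.sum_sub_distrib]
    rw [sum_sub_right]
    simp
  rw [Finset.sum_eq_add 0 1 zero_ne_one] at h1
  · linear_combination h1
  · intro k _ hk; rw [hm k hk.1 hk.2, sub_self]
  · simp
  · simp

theorem step_add_step_one_sub {l : ZMod p → ZMod p} {m : ZMod p}
    (hm : ∀ k, k ≠ 0 → k ≠ 1 → step l k = m) (k : ZMod p) : step l k + step l (1 - k) = 2 * m := by
  by_cases h0 : k = 0
  · rw [h0, sub_zero, step_add_step hm]
  by_cases h1 : k = 1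
  · rw [h1, sub_self, add_comm, step_add_step hm]
  rw [hm k h0 h1, hm (1 - k) (fun h => h1 (sub_eq_zero.1 h).symm) (fun h => h0 (by simpa using h))]
  ring

/-- Evenness of `step₂` at k - 1 says that k ↦ step l k + step l (1 - k) takes the same value at k -
1 and k. -/
theorem step₂_symm_iff (l : ZMod p → ZMod p) : (∀ k, step₂ l k = step₂ l (-k)) ↔
    ∀ k, step l k + step l (1 - k) = step l 0 + step l 1 := by
  have h1 : ∀ k, step₂ l (k - 1) = step₂ l (-(k - 1)) ↔
      step l (k - 1) + step l (1 - (k - 1)) = step l k + step l (1 - k) := by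
    intro k
    simp only [step₂]
    rw [sub_add_cancel, neg_sub, show 1 - (k - 1) = 1 - k + 1 by ring]
    constructor <;> intro h <;> linear_combination h
  constructor
  · intro h k
    have := eq_of_forall_sub_one (fun k => step l k + step l (1 - k)) (fun k => (h1 k).1 (h _)) k
    simpa using this
  · intro h k
    have := (h1 (k + 1)).2 (by rw [h, h])
    simpa using this

theorem step₂_symm_of_const {l : ZMod p → ZMod p} {m : ZMod p}
    (hm : ∀ k, k ≠ 0 → k ≠ 1 → step l k = m) (k : ZMod p) : step₂ l k = step₂ l (-k) :=
  (step₂_symm_iff l).2 (fun k => by rw [step_add_step_one_sub hm, step_add_step hm]) k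

theorem moment_eq_zero_of_const (hp : p ≠ 2) {l : ZMod p → ZMod p} {m : ZMod p}
    (hm : ∀ k, k ≠ 0 → k ≠ 1 → step l k = m) (k : ZMod p) :
    k * step l k - (k + 1) * step l (k + 1) + step l (1 - k) = 0 := by
  have h1 := step_add_step_one_sub hm k
  -- Away from k = 0, each side vanishes through its coefficient or because the step equals m.
  suffices (k - 1) * (step l k - m) = (k + 1) * (step l (k + 1) - m) by
    linear_combination this + h1
  have h01 := step_add_step hm
  by_cases h0 : k = 0
  · subst h0; rw [zero_add]; linear_combination -h01
  by_cases h2 : k = 1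
  · subst h2
    rw [hm (1 + 1)]
    · ring
    · rw [one_add_one_eq_two]; exact two_ne_zero' hp
    · simp
  by_cases h3 : k = -1
  · subst h3
    rw [hm (-1) h0 h2]
    ring
  · rw [hm k h0 h2, hm (k + 1) (fun h => h3 (eq_neg_of_add_eq_zero_left h)) (by simpa using h0)]
    ring

theorem const_of_moment_eq_zero (hp : p ≠ 2) {l : ZMod p → ZMod p}
    (h : ∀ k, step₂ l k = step₂ l (-k))
    (h' : ∀ k, k * step l k - (k + 1) * step l (k + 1) + step l (1 - k) = 0) :
    ∃ m, ∀ k, k ≠ 0 → k ≠ 1 → step l k = m := by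
  have h2 := two_ne_zero' hp
  obtain ⟨m, hm⟩ : ∃ m, step l 0 + step l 1 = 2 * m := ⟨_, (mul_div_cancel₀ _ h2).symm⟩
  refine ⟨m, fun k h0 h1 => ?_⟩
  have hs := (step₂_symm_iff l).1 h
  -- Eliminating step l (1 - k) between the two hypotheses gives a first-order recurrence; with the
  -- integrating factor k (k - 1) it says that this function is constant, and its value at 0 is 0.
  have h3 := eq_of_forall_sub_one (fun k => k * (k - 1) * (step l k - m)) (fun k => by
    have ha := h' (k - 1)
    have hb := hs (k - 1)
    rw [sub_add_cancel] at ha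
    linear_combination (k - 1) * (ha - hb - hm)) k
  simp only [zero_mul, mul_eq_zero, h0, false_or, sub_eq_zero, h1] at h3
  exact h3

end Tuple
/-! ## Powers with exponents modulo `p` -/

section ModPow

variable {Q : Type*} [Group Q] {p : ℕ} {a b : Q}

/-- The power of `a` with exponent a residue class modulo `p`. -/
def modPow (a : Q) (x : ZMod p) : Q := a ^ x.val

theorem modPow_zero (a : Q) : modPow a (0 : ZMod p) = 1 := by simp [modPow]

theorem map_modPow {Q' : Type*} [Group Q'] (f : Q →* Q') (x : ZMod p) :
    f (modPow a x) = modPow (f a) x := map_pow f a _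

theorem modPow_commute (x y : ZMod p) : Commute (modPow a x) (modPow a y) :=
  Commute.pow_pow (Commute.refl a) _ _

theorem modPow_conj (x : ZMod p) : modPow (b * a * b⁻¹) x = b * modPow a x * b⁻¹ := conj_pow

theorem conj_pow_eq_one (ha : a ^ p = 1) : (b * a * b⁻¹) ^ p = 1 := by
  rw [conj_pow, ha, mul_one, mul_inv_cancel]

open scoped commutatorElement

/-- The commutator is a power of a times a power of b a b⁻¹, and both commute with a. -/
theorem commute_commutator_modPow (h : Commute (b * a * b⁻¹) a) (k k' : ZMod p) :
    Commute ⁅modPow a k, b⁆ (modPow a k') := by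
  have h1 : ⁅modPow a k, b⁆ = modPow a k * (modPow (b * a * b⁻¹) k)⁻¹ := by
    rw [modPow_conj, commutatorElement_def]; group
  rw [h1]
  exact (modPow_commute k k').mul_left (Commute.inv_left (h.pow_pow _ _))

variable [Fact p.Prime]

theorem modPow_one (a : Q) : modPow a (1 : ZMod p) = a := by
  have : Fact (1 < p) := ⟨(Fact.out : p.Prime).one_lt⟩
  rw [modPow, ZMod.val_one, pow_one]

theorem modPow_add (ha : a ^ p = 1) (x y : ZMod p) : modPow a (x + y) = modPow a x * modPow a y := by
  rw [modPow, modPow, modPow, ← pow_add, ZMod.val_add, ← pow_eq_pow_mod _ ha]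

theorem modPow_neg (ha : a ^ p = 1) (x : ZMod p) : modPow a (-x) = (modPow a x)⁻¹ := by
  rw [eq_inv_iff_mul_eq_one, ← modPow_add ha, neg_add_cancel, modPow_zero]

theorem modPow_mul (ha : a ^ p = 1) (x y : ZMod p) : modPow a (x * y) = modPow (modPow a x) y := by
  rw [modPow, modPow, modPow, ← pow_mul, ZMod.val_mul, ← pow_eq_pow_mod _ ha]

theorem commute_of_modPow (ha : a ^ p = 1) {x : ZMod p} (hx : x ≠ 0) (h : Commute (modPow a x) b) :
    Commute a b := by
  have : a = modPow (modPow a x) x⁻¹ := by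
    rw [← modPow_mul ha, mul_inv_cancel₀ hx, modPow_one]
  rw [this]
  exact h.pow_left _

/-- b a^k b⁻¹ = [b, a^k] a^k commutes with a, and the exponent k is invertible modulo p. -/
theorem commute_conj_of_commute (ha : a ^ p = 1) {k : ZMod p} (hk : k ≠ 0)
    (h : Commute ⁅b, modPow a k⁆ a) : Commute (b * a * b⁻¹) a := by
  refine commute_of_modPow (conj_pow_eq_one ha) hk ?_
  rw [modPow_conj]
  have h1 : b * modPow a k * b⁻¹ = ⁅b, modPow a k⁆ * modPow a k := by
    rw [commutatorElement_def, inv_mul_cancel_right]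
  rw [h1]
  exact h.mul_left ((Commute.refl a).pow_left _)

/-- As b a b⁻¹ and a commute, [b, a^k] = [b, a]^k, and k is invertible modulo the exponent p. -/
theorem commute_commutator_right (ha : a ^ p = 1) (h : Commute (b * a * b⁻¹) a) {k : ZMod p}
    (hk : k ≠ 0) (hb : Commute ⁅b, modPow a k⁆ b) : Commute ⁅a, b⁆ b := by
  have h1 : ⁅b, modPow a k⁆ = modPow ⁅b, a⁆ k := by
    have : ⁅b, modPow a k⁆ = modPow (b * a * b⁻¹) k * (modPow a k)⁻¹ := by
      rw [modPow_conj, commutatorElement_def]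
    rw [this, commutatorElement_def, modPow, modPow, modPow, h.inv_right.mul_pow, inv_pow]
  have h2 : ⁅b, a⁆ ^ p = 1 := by
    rw [commutatorElement_def, h.inv_right.mul_pow, conj_pow_eq_one ha, inv_pow, ha, inv_one, mul_one]
  rw [h1] at hb
  rw [← commutatorElement_inv]
  exact (commute_of_modPow h2 hk hb).inv_left

/-- The product of the two commuting elements, in the opposite order, is b^(1-r). So b^(1-r), hence
b, commutes with b a^(-s), hence with a. -/
theorem commute_of_commute_products (ha : a ^ p = 1) (hb : b ^ p = 1) {s r : ZMod p} (hs : s ≠ 0)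
    (hr : r ≠ 1) (h : Commute (modPow a s * modPow b (-r)) (b * modPow a (-s))) : Commute a b := by
  have h1 : b * modPow a (-s) * (modPow a s * modPow b (-r)) = modPow b (1 - r) := by
    rw [mul_assoc, ← mul_assoc (modPow a (-s)), ← modPow_add ha, neg_add_cancel, modPow_zero,
      one_mul, sub_eq_add_neg, modPow_add hb, modPow_one]
  have h2 : Commute (modPow b (1 - r)) (b * modPow a (-s)) := by
    rw [← h1]; exact (Commute.refl _).mul_left h
  have h3 := commute_of_modPow hb (sub_ne_zero.2 hr.symm) h2
  have h4 : Commute b (modPow a (-s)) := by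
    have := (Commute.refl b).inv_right.mul_right h3
    rwa [inv_mul_cancel_left] at this
  exact commute_of_modPow ha (neg_ne_zero.2 hs) h4.symm

end ModPow

/-! ## Commutators in two-generated groups -/

section TwoGenerated

open scoped commutatorElement

variable {A : Type*} [Group A] {a b : A}

theorem commute_mk_iff (N : Subgroup A) [N.Normal] (x y : A) :
    Commute (QuotientGroup.mk' N x) (QuotientGroup.mk' N y) ↔ ⁅x, y⁆ ∈ N := by
  rw [← commutatorElement_eq_one_iff_commute, ← map_commutatorElement]
  exact QuotientGroup.eq_one_iff _

theorem centralizer_eq_top (hab : Subgroup.closure {a, b} = ⊤) {c : A} (ha : Commute c a)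
    (hb : Commute c b) (x : A) : Commute c x := by
  have : Subgroup.closure {a, b} ≤ Subgroup.centralizer {c} := by
    rw [Subgroup.closure_le]
    rintro x (rfl | rfl)
    · exact Subgroup.mem_centralizer_singleton_iff.2 ha.symm
    · exact Subgroup.mem_centralizer_singleton_iff.2 hb.symm
  rw [hab] at this
  exact (Subgroup.mem_centralizer_singleton_iff.1 (this (Subgroup.mem_top x))).symm

theorem closure_map_eq_top {Q : Type*} [Group Q] (f : A →* Q) (hf : Function.Surjective f)
    (hab : Subgroup.closure {a, b} = ⊤) : Subgroup.closure {f a, f b} = ⊤ := by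
  rw [← Set.image_pair, ← MonoidHom.map_closure, hab, ← MonoidHom.range_eq_map,
    MonoidHom.range_eq_top.2 hf]

theorem commute_of_generators (hab : Subgroup.closure {a, b} = ⊤) (h : Commute a b) (x y : A) :
    Commute x y := by
  refine (centralizer_eq_top hab ?_ ?_ x).symm
  · exact (centralizer_eq_top hab (Commute.refl a) h y).symm
  · exact (centralizer_eq_top hab h.symm (Commute.refl b) y).symm

theorem commutator_le_of_generators (hab : Subgroup.closure {a, b} = ⊤) (N : Subgroup A) [N.Normal]
    (h : ⁅a, b⁆ ∈ N) : ⁅(⊤ : Subgroup A), ⊤⁆ ≤ N := by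
  rw [Subgroup.commutator_le]
  intro x _ y _
  rw [← commute_mk_iff]
  exact commute_of_generators (closure_map_eq_top _ (QuotientGroup.mk'_surjective N) hab)
    ((commute_mk_iff N a b).2 h) _ _

/-- Modulo N the commutator of the generators is central, so the derived subgroup, being its normal
closure, is central too. -/
theorem gamma3_le_of_generators (hab : Subgroup.closure {a, b} = ⊤) (N : Subgroup A) [N.Normal]
    (ha : ⁅⁅a, b⁆, a⁆ ∈ N) (hb : ⁅⁅a, b⁆, b⁆ ∈ N) : ⁅⁅(⊤ : Subgroup A), (⊤ : Subgroup A)⁆, (⊤ : Subgroup A)⁆ ≤ N := by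
  have hle : ⁅(⊤ : Subgroup A), ⊤⁆ ≤
      (Subgroup.center (A ⧸ N)).comap (QuotientGroup.mk' N) := by
    refine commutator_le_of_generators hab _ ?_
    rw [Subgroup.mem_comap, Subgroup.mem_center_iff]
    intro g
    have hab' := closure_map_eq_top _ (QuotientGroup.mk'_surjective N) hab
    exact (centralizer_eq_top hab' ((commute_mk_iff N _ _).2 ha) ((commute_mk_iff N _ _).2 hb) g).symm
  rw [Subgroup.commutator_le]
  intro x hx y _
  rw [← commute_mk_iff]
  exact (Subgroup.mem_center_iff.1 (hle hx) _).symm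

end TwoGenerated

/-! ## Subgroups of a power of a group -/

section PowerGroup

open scoped commutatorElement

variable {p : ℕ} {A : Type*} [Group A]

/-- The cyclic shift of the coordinates. -/
def rot (p : ℕ) (A : Type*) [Group A] : (ZMod p → A) →* (ZMod p → A) where
  toFun g := fun k => g (k - 1)
  map_one' := rfl
  map_mul' _ _ := rfl

@[simp] theorem rot_apply (g : ZMod p → A) (k : ZMod p) : rot p A g k = g (k - 1) := rfl

theorem rot_mulSingle (k : ZMod p) (g : A) :
    rot p A (Pi.mulSingle k g) = Pi.mulSingle (k + 1) g := by
  funext j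
  by_cases h : j = k + 1
  · subst h; simp
  · rw [rot_apply, Pi.mulSingle_eq_of_ne h, Pi.mulSingle_eq_of_ne fun h' => h (sub_eq_iff_eq_add.1 h')]

/-- The elements `g` such that `(g, 1, …, 1)` is in `H`. -/
def rist (H : Subgroup (ZMod p → A)) : Subgroup A :=
  H.comap (MonoidHom.mulSingle (fun _ => A) 0)

theorem mem_rist {H : Subgroup (ZMod p → A)} {g : A} :
    g ∈ rist H ↔ (Pi.mulSingle 0 g : ZMod p → A) ∈ H := Iff.rfl

theorem map_rot_commutator_le {H : Subgroup (ZMod p → A)} (hH : H.map (rot p A) ≤ H) :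
    (⁅H, H⁆).map (rot p A) ≤ ⁅H, H⁆ := by
  rw [Subgroup.map_commutator]
  exact Subgroup.commutator_mono hH hH

theorem conj_mem_commutator {Γ : Type*} [Group Γ] {S H : Subgroup Γ} (h : ∀ s ∈ S, ∀ g ∈ H, s * g * s⁻¹ ∈ H)
    (s : Γ) (hs : s ∈ S) (g : Γ) (hg : g ∈ ⁅H, H⁆) : s * g * s⁻¹ ∈ ⁅H, H⁆ := by
  have h1 : H.map (MulAut.conj s).toMonoidHom ≤ H := by
    rintro _ ⟨x, hx, rfl⟩
    exact h s hs x hx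
  have h2 : (⁅H, H⁆).map (MulAut.conj s).toMonoidHom ≤ ⁅H, H⁆ := by
    rw [Subgroup.map_commutator]
    exact Subgroup.commutator_mono h1 h1
  exact h2 ⟨g, hg, rfl⟩

/-- Conjugating a tuple supported at 0 only sees the coordinate 0 of the conjugating element, which
is arbitrary in A. -/
theorem rist_normal {S H : Subgroup (ZMod p → A)} (hS : ∀ g, ∃ s ∈ S, s 0 = g)
    (h : ∀ s ∈ S, ∀ g ∈ H, s * g * s⁻¹ ∈ H) : (rist H).Normal where
  conj_mem n hn g := by
    obtain ⟨s, hs, rfl⟩ := hS g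
    have : (Pi.mulSingle 0 (s 0 * n * (s 0)⁻¹) : ZMod p → A) = s * Pi.mulSingle 0 n * s⁻¹ := by
      funext k
      by_cases hk : k = 0
      · subst hk; simp
      · simp [Pi.mulSingle_eq_of_ne hk]
    rw [mem_rist, this]
    exact h s hs _ hn

variable [NeZero p]

theorem mulSingle_mem_of_mulSingle_mem {H : Subgroup (ZMod p → A)} (hH : H.map (rot p A) ≤ H) {g : A} {k : ZMod p}
    (h : Pi.mulSingle k g ∈ H) (j : ZMod p) : Pi.mulSingle j g ∈ H := by
  have : ∀ n : ℕ, Pi.mulSingle (k + n) g ∈ H := by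
    intro n
    induction n with
    | zero => simpa using h
    | succ n ih =>
      have := hH ⟨_, ih, rfl⟩
      rw [rot_mulSingle] at this
      simpa [add_assoc] using this
  have h2 := this (j - k).val
  rwa [ZMod.natCast_zmod_val, add_sub_cancel] at h2

theorem mulSingle_mem_iff {H : Subgroup (ZMod p → A)} (hH : H.map (rot p A) ≤ H) {g : A}
    {k : ZMod p} : Pi.mulSingle k g ∈ H ↔ g ∈ rist H :=
  ⟨fun h => mulSingle_mem_of_mulSingle_mem hH h 0, fun h => mulSingle_mem_of_mulSingle_mem hH h k⟩

/-- The device for isolating a coordinate: a tuple in H supported on i and j may be divided by its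
entry at j once that entry alone belongs to H. -/
theorem mem_rist_of_mem {H : Subgroup (ZMod p → A)} (hH : H.map (rot p A) ≤ H) {z : ZMod p → A}
    (hz : z ∈ H) {i j : ZMod p} (hij : i ≠ j) (h : ∀ k, k ≠ i → k ≠ j → z k = 1)
    (hj : z j ∈ rist H) : z i ∈ rist H := by
  rw [← mulSingle_mem_iff hH (k := i)]
  have : (Pi.mulSingle i (z i) : ZMod p → A) = z * (Pi.mulSingle j (z j))⁻¹ := by
    funext k
    rw [Pi.mul_apply, Pi.inv_apply]
    by_cases hi : k = i
    · subst hi; simp [Pi.mulSingle_eq_of_ne hij]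
    by_cases hj : k = j
    · subst hj; simp [Pi.mulSingle_eq_of_ne hi]
    · simp [Pi.mulSingle_eq_of_ne hi, Pi.mulSingle_eq_of_ne hj, h k hi hj]
  rw [this]
  exact H.mul_mem hz (H.inv_mem ((mulSingle_mem_iff hH).2 hj))

theorem pi_le_of_le_rist {H : Subgroup (ZMod p → A)} (hH : H.map (rot p A) ≤ H) {N : Subgroup A}
    (hN : N ≤ rist H) {g : ZMod p → A} (hg : ∀ k, g k ∈ N) : g ∈ H := by
  have : Subgroup.pi Set.univ (fun _ : ZMod p => N) ≤ H := by
    rw [Subgroup.pi_le_iff]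
    rintro i _ ⟨x, hx, rfl⟩
    exact (mulSingle_mem_iff hH).2 (hN hx)
  exact this fun k _ => hg k

end PowerGroup
/-! ## Geometric tuples -/

section Geometric

variable {p : ℕ} [Fact p.Prime]

/-- If all the minors below vanish, the tuple `l` is a geometric progression. -/
theorem geometric_of_minors (hp : p ≠ 2) {l : ZMod p → ZMod p} (h0 : l 0 = 0)
    (hne : ∃ d, l d ≠ 0) (hneg : ∀ d, l d = 0 → l (-d) = 0)
    (hM : ∀ d, l d ≠ 0 → ∀ j k, j ≠ 0 → j ≠ d → k ≠ 0 → k ≠ d → l j * l (k - d) = l k * l (j - d))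
    (hZ : ∀ d, l d ≠ 0 → ∀ k, k ≠ 0 → k ≠ d → l (k - d) = 0 → l k = 0) :
    ∃ r, l 1 ≠ 0 ∧ (∀ k, k ≠ 0 → k ≠ 1 → l k = r * l (k - 1)) ∧ l 1 = r * l (-1) := by
  obtain ⟨d, hd⟩ := hne
  have hd0 : d ≠ 0 := by rintro rfl; exact hd h0
  -- Non-vanishing propagates along -d, -2d, …, by `hZ` read contrapositively; these multiples
  -- exhaust the non-zero residues.
  have hmul : ∀ n : ℕ, n + 1 < p → l (-((n + 1 : ℕ) * d)) ≠ 0 := by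
    intro n
    induction n with
    | zero => intro _ h; simp at h; exact hd (by simpa using hneg _ h)
    | succ n ih =>
      intro hn h
      refine ih (by omega) (hZ d hd _ ?_ ?_ ?_)
      · exact neg_ne_zero.2 (mul_ne_zero (natCast_ne_zero_of_lt (by omega) (by omega)) hd0)
      · intro h'
        have : ((n + 1 + 1 : ℕ) : ZMod p) * d = 0 := by push_cast at h' ⊢; linear_combination -h'
        exact mul_ne_zero (natCast_ne_zero_of_lt (by omega) (by omega)) hd0 this
      · rw [← h]; congr 1; push_cast; ring
  have hall : ∀ k, k ≠ 0 → l k ≠ 0 := by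
    intro k hk
    have hx : -k / d ≠ 0 := div_ne_zero (neg_ne_zero.2 hk) hd0
    have hv : (-k / d).val ≠ 0 := fun h => hx ((ZMod.val_eq_zero _).1 h)
    have hlt := ZMod.val_lt (-k / d)
    have := hmul ((-k / d).val - 1) (by omega)
    rw [Nat.sub_add_cancel (by omega), ZMod.natCast_zmod_val, div_mul_cancel₀ _ hd0, neg_neg] at this
    exact this
  have h1 : l 1 ≠ 0 := hall 1 one_ne_zero
  have h21 : (2 : ZMod p) ≠ 1 := fun h => one_ne_zero (α := ZMod p) (by linear_combination h)
  have hgeo : ∀ k, k ≠ 0 → k ≠ 1 → l k = l 2 / l 1 * l (k - 1) := by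
    intro k hk0 hk1
    have := hM 1 h1 k 2 hk0 hk1 (two_ne_zero' hp) h21
    rw [show (2 : ZMod p) - 1 = 1 by ring] at this
    rw [div_mul_eq_mul_div, eq_div_iff h1, this]
  refine ⟨l 2 / l 1, h1, hgeo, ?_⟩
  have hr : l 2 / l 1 ≠ 0 := div_ne_zero (hall 2 (two_ne_zero' hp)) h1
  have hpow : ∀ n : ℕ, n + 1 < p → l ((n + 1 : ℕ) : ZMod p) = (l 2 / l 1) ^ n * l 1 := by
    intro n
    induction n with
    | zero => intro _; simp
    | succ n ih =>
      intro hn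
      rw [hgeo _ (natCast_ne_zero_of_lt (by omega) (by omega))
        (natCast_ne_one_of_lt (by omega) (by omega))]
      have : ((n + 1 + 1 : ℕ) : ZMod p) - 1 = ((n + 1 : ℕ) : ZMod p) := by push_cast; ring
      rw [this, ih (by omega), pow_succ']
      ring
  have h2p : 2 ≤ p := (Fact.out : p.Prime).two_le
  have hlast := hpow (p - 2) (by omega)
  have hcast : ((p - 2 + 1 : ℕ) : ZMod p) = -1 := by
    rw [eq_neg_iff_add_eq_zero]
    have : p - 2 + 1 + 1 = p := by omega
    have h3 : ((p - 2 + 1 + 1 : ℕ) : ZMod p) = 0 := by rw [this, ZMod.natCast_self]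
    rw [← h3]; push_cast; ring
  rw [hcast] at hlast
  -- The progression closes up around the cycle by Fermat: r^(p-1) = 1.
  rw [hlast, ← mul_assoc, ← pow_succ', show p - 2 + 1 = p - 1 by omega,
    ZMod.pow_card_sub_one_eq_one hr, one_mul]

end Geometric

/-! ## The first-level sections of a GGS-group -/

section Sections

open scoped commutatorElement

variable {p : ℕ} {A : Type*} [Group A]

/-- The sections of the conjugate `a ^ i * b * a ^ (-i)`. -/
def dirSect (l : ZMod p → ZMod p) (a b : A) (i : ZMod p) : ZMod p → A :=
  fun k => if k = i then b else modPow a (l (k - i))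

/-- The sections of the quotient of two neighbouring conjugates of `b`. -/
def dirQuot (l : ZMod p → ZMod p) (a b : A) (i : ZMod p) : ZMod p → A :=
  dirSect l a b i * (dirSect l a b (i + 1))⁻¹

/-- The properties used of the group `A = ⟨a, b⟩` and of the groups `S` and `D` of the tuples of
first-level sections of the elements of the first level stabiliser and of the derived subgroup. -/
structure SectionGroups (l : ZMod p → ZMod p) (a b : A) (S D : Subgroup (ZMod p → A)) : Prop where
  pow_a : a ^ p = 1
  pow_b : b ^ p = 1
  closure_eq : Subgroup.closure {a, b} = ⊤
  zero : l 0 = 0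
  step_ne : ∃ k, k ≠ 0 ∧ k ≠ 1 ∧ step l k ≠ 0
  mem : ∀ i, dirSect l a b i ∈ S
  comm_le : ⁅S, S⁆ ≤ D
  le : D ≤ S
  rot_S : S.map (rot p A) ≤ S
  rot_D : D.map (rot p A) ≤ D
  quot_mem : ∀ i, dirQuot l a b i ∈ D
  le_closure : D ≤ Subgroup.closure {x | ∃ s ∈ S, ∃ i, x = s * dirQuot l a b i * s⁻¹}

variable {l : ZMod p → ZMod p} {a b : A} {S D : Subgroup (ZMod p → A)}

theorem dirSect_self (i : ZMod p) : dirSect l a b i i = b := if_pos rfl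

theorem dirSect_of_ne {i k : ZMod p} (h : k ≠ i) : dirSect l a b i k = modPow a (l (k - i)) := if_neg h

theorem commutator_dirSect_of_ne {d k : ZMod p} (h0 : k ≠ 0) (hd : k ≠ d) :
    ⁅dirSect l a b 0, dirSect l a b d⁆ k = 1 := by
  change ⁅dirSect l a b 0 k, dirSect l a b d k⁆ = 1
  rw [dirSect_of_ne h0, dirSect_of_ne hd, commutatorElement_eq_one_iff_commute]
  exact modPow_commute _ _

theorem commutator_dirSect_zero {d : ZMod p} (hd : d ≠ 0) :
    ⁅dirSect l a b 0, dirSect l a b d⁆ 0 = ⁅b, modPow a (l (-d))⁆ := by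
  change ⁅dirSect l a b 0 0, dirSect l a b d 0⁆ = _
  rw [dirSect_self, dirSect_of_ne hd.symm, zero_sub]

theorem commutator_dirSect_right {d : ZMod p} (hd : d ≠ 0) :
    ⁅dirSect l a b 0, dirSect l a b d⁆ d = ⁅modPow a (l d), b⁆ := by
  change ⁅dirSect l a b 0 d, dirSect l a b d d⁆ = _
  rw [dirSect_self, dirSect_of_ne hd, sub_zero]

namespace SectionGroups

variable (h : SectionGroups l a b S D)

include h

theorem conj_mem_D (s : ZMod p → A) (hs : s ∈ S) (g : ZMod p → A) (hg : g ∈ D) : s * g * s⁻¹ ∈ D := by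
  have h1 : ⁅s, g⁆ * g ∈ D :=
    D.mul_mem (h.comm_le (Subgroup.commutator_mem_commutator hs (h.le hg))) hg
  rwa [commutatorElement_def, inv_mul_cancel_right] at h1

theorem comm_S_le : ⁅S, S⁆ ≤ S := h.comm_le.trans h.le

variable [Fact p.Prime]

theorem exists_ne_zero : ∃ d, l d ≠ 0 := by
  obtain ⟨k, -, -, hk⟩ := h.step_ne
  by_contra! h'
  exact hk (by rw [step, h', h', sub_zero])

theorem dirQuot_apply_of_ne {i k : ZMod p} (h0 : k ≠ i) (h1 : k ≠ i + 1) :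
    dirQuot l a b i k = modPow a (step l (k - i)) := by
  change dirSect l a b i k * (dirSect l a b (i + 1) k)⁻¹ = _
  rw [dirSect_of_ne h0, dirSect_of_ne h1, ← modPow_neg h.pow_a, ← modPow_add h.pow_a, step,
    sub_eq_add_neg (l (k - i)), sub_sub]

theorem dirQuot_apply_zero : dirQuot l a b 0 0 = b * modPow a (- l (-1)) := by
  change dirSect l a b 0 0 * (dirSect l a b (0 + 1) 0)⁻¹ = _
  rw [dirSect_self, dirSect_of_ne (by simp), ← modPow_neg h.pow_a]
  simp

/-- `D` projects onto `A` in every coordinate. -/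
theorem exists_mem_D (g : A) : ∃ s ∈ D, s 0 = g := by
  obtain ⟨k, hk0, hk1, hk⟩ := h.step_ne
  let P : Subgroup A := D.map (Pi.evalMonoidHom (fun _ : ZMod p => A) 0)
  have h1 : modPow a (step l k) ∈ P := by
    refine ⟨dirQuot l a b (-k), h.quot_mem _, ?_⟩
    change dirQuot l a b (-k) 0 = _
    rw [h.dirQuot_apply_of_ne (neg_ne_zero.2 hk0).symm, zero_sub, neg_neg]
    intro h'
    exact hk1 (by linear_combination h')
  have ha : a ∈ P := by
    have : a = modPow (modPow a (step l k)) (step l k)⁻¹ := by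
      rw [← modPow_mul h.pow_a, mul_inv_cancel₀ hk, modPow_one]
    rw [this]
    exact P.pow_mem h1 _
  have hb : b ∈ P := by
    have h2 : b * modPow a (- l (-1)) ∈ P := ⟨_, h.quot_mem 0, h.dirQuot_apply_zero⟩
    have := P.mul_mem h2 (P.inv_mem (P.pow_mem ha (-l (-1)).val))
    rwa [modPow, mul_inv_cancel_right] at this
  have hP : P = ⊤ := by
    rw [eq_top_iff, ← h.closure_eq, Subgroup.closure_le]
    rintro x (rfl | rfl)
    exacts [ha, hb]
  obtain ⟨s, hs, hs'⟩ : g ∈ P := hP ▸ Subgroup.mem_top g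
  exact ⟨s, hs, hs'⟩

theorem exists_mem_S (g : A) : ∃ s ∈ S, s 0 = g := by
  obtain ⟨s, hs, h'⟩ := h.exists_mem_D g
  exact ⟨s, h.le hs, h'⟩

theorem rist_S_normal : (rist ⁅S, S⁆).Normal :=
  rist_normal h.exists_mem_S
    (conj_mem_commutator fun _ hs _ hg => S.mul_mem (S.mul_mem hs hg) (S.inv_mem hs))

theorem rist_D_normal : (rist ⁅D, D⁆).Normal :=
  rist_normal h.exists_mem_S (conj_mem_commutator h.conj_mem_D)

/-- Commuting x, which is supported on 0 and d, with w keeps the support; if the entry at d is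
harmless, the entry at 0 is isolated. -/
theorem commutator_mem_rist {d : ZMod p} (hd : d ≠ 0) {x w : ZMod p → A} (hx : x ∈ ⁅S, S⁆)
    (hx' : ∀ k, k ≠ 0 → k ≠ d → x k = 1) (hw : w ∈ S) (hc : ⁅x d, w d⁆ ∈ rist ⁅S, S⁆) :
    ⁅x 0, w 0⁆ ∈ rist ⁅S, S⁆ := by
  refine mem_rist_of_mem (map_rot_commutator_le h.rot_S)
    (Subgroup.commutator_mem_commutator (h.comm_S_le hx) hw) hd.symm (fun k h0 hk => ?_) hc
  change ⁅x k, w k⁆ = 1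
  rw [hx' k h0 hk, commutatorElement_one_left]

theorem commutator_dirSect_mem (d : ZMod p) : ⁅dirSect l a b 0, dirSect l a b d⁆ ∈ ⁅S, S⁆ :=
  Subgroup.commutator_mem_commutator (h.mem 0) (h.mem d)

/-- If the zeros of `l` are not symmetric, the generators commute modulo `rist`. -/
theorem commutator_mem_of_eq_zero {d : ZMod p} (hd : l d = 0) (hd' : l (-d) ≠ 0) :
    ⁅a, b⁆ ∈ rist ⁅S, S⁆ := by
  have hd0 : d ≠ 0 := by rintro rfl; rw [neg_zero, h.zero] at hd'; exact hd' rfl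
  have := h.rist_S_normal
  have h1 : ⁅b, modPow a (l (-d))⁆ ∈ rist ⁅S, S⁆ := by
    rw [← commutator_dirSect_zero hd0]
    refine mem_rist_of_mem (map_rot_commutator_le h.rot_S) (h.commutator_dirSect_mem d) hd0.symm
      (fun k => commutator_dirSect_of_ne) ?_
    rw [commutator_dirSect_right hd0, hd, modPow_zero, commutatorElement_one_left]
    exact one_mem _
  rw [← commute_mk_iff, map_modPow] at h1
  rw [← commute_mk_iff]
  exact commute_of_modPow (by rw [← map_pow, h.pow_a, map_one]) hd' h1.symm

/-- An element of `S` that is trivial in the coordinate `d` and a power of `a` in the coordinate `0`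
shows that `a` commutes with `b * a * b⁻¹` modulo `rist`. -/
theorem commute_conj_of_mem [hn : (rist ⁅S, S⁆).Normal] {d t : ZMod p} (hd : l (-d) ≠ 0) {w : ZMod p → A} (hw : w ∈ S)
    (hwd : w d = 1) (hw0 : w 0 = modPow a t) (ht : t ≠ 0) :
    Commute (QuotientGroup.mk' (rist ⁅S, S⁆) (b * a * b⁻¹)) (QuotientGroup.mk' (rist ⁅S, S⁆) a) := by
  have hd0 : d ≠ 0 := by rintro rfl; rw [neg_zero, h.zero] at hd; exact hd rfl
  have hqa : QuotientGroup.mk' (rist ⁅S, S⁆) a ^ p = 1 := by rw [← map_pow, h.pow_a, map_one]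
  have h1 := h.commutator_mem_rist hd0 (h.commutator_dirSect_mem d)
    (fun k => commutator_dirSect_of_ne) hw (by rw [hwd, commutatorElement_one_right]; exact one_mem _)
  rw [commutator_dirSect_zero hd0, hw0, ← commute_mk_iff, map_modPow, map_commutatorElement,
    map_modPow] at h1
  simp only [map_mul, map_inv]
  exact commute_conj_of_commute hqa hd (commute_of_modPow hqa ht h1.symm).symm

/-- If it failed, no product of conjugates of b could be trivial at one coordinate and a non-trivial
power of a at another in the way `commute_conj_of_mem` needs. This makes l geometric, and then a and
b themselves commute modulo `rist`, a contradiction. -/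
theorem commute_conj [hn : (rist ⁅S, S⁆).Normal] (hp : p ≠ 2) :
    Commute (QuotientGroup.mk' (rist ⁅S, S⁆) (b * a * b⁻¹)) (QuotientGroup.mk' (rist ⁅S, S⁆) a) := by
  by_contra hcon
  have hab : ¬ Commute (QuotientGroup.mk' (rist ⁅S, S⁆) a) (QuotientGroup.mk' (rist ⁅S, S⁆) b) := by
    intro h'
    apply hcon
    simp only [map_mul, map_inv]
    rw [h'.symm.eq, mul_inv_cancel_right]
  have hneg : ∀ d, l d = 0 → l (-d) = 0 := by
    intro d hd
    by_contra hd'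
    exact hab ((commute_mk_iff _ _ _).2 (h.commutator_mem_of_eq_zero hd hd'))
  have hneg' : ∀ d, l d ≠ 0 → l (-(-d)) ≠ 0 := fun d hd => by rwa [neg_neg]
  -- The exponents of w are chosen to cancel at the coordinate -d; at the coordinate 0 the exponent
  -- of a is then exactly the minor.
  have hM : ∀ d, l d ≠ 0 → ∀ j k, j ≠ 0 → j ≠ d → k ≠ 0 → k ≠ d →
      l j * l (k - d) = l k * l (j - d) := by
    intro d hd j k hj0 hjd hk0 hkd
    by_contra hne
    refine hcon (h.commute_conj_of_mem (d := -d) (hneg' d hd)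
      (w := dirSect l a b (-j) ^ (l (k - d)).val * dirSect l a b (-k) ^ (-l (j - d)).val)
      (S.mul_mem (S.pow_mem (h.mem _) _) (S.pow_mem (h.mem _) _)) ?_ ?_ (sub_ne_zero.2 hne))
    · change modPow (dirSect l a b (-j) (-d)) (l (k - d)) *
        modPow (dirSect l a b (-k) (-d)) (-l (j - d)) = 1
      rw [dirSect_of_ne (fun h => hjd (neg_injective h).symm),
        dirSect_of_ne (fun h => hkd (neg_injective h).symm), ← modPow_mul h.pow_a,
        ← modPow_mul h.pow_a, ← modPow_add h.pow_a, neg_sub_neg, neg_sub_neg]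
      rw [← modPow_zero (p := p) a]; congr 1; ring
    · change modPow (dirSect l a b (-j) 0) (l (k - d)) *
        modPow (dirSect l a b (-k) 0) (-l (j - d)) = _
      rw [dirSect_of_ne (neg_ne_zero.2 hj0).symm, dirSect_of_ne (neg_ne_zero.2 hk0).symm,
        ← modPow_mul h.pow_a, ← modPow_mul h.pow_a, ← modPow_add h.pow_a, zero_sub, zero_sub,
        neg_neg, neg_neg]
      congr 1; ring
  have hZ : ∀ d, l d ≠ 0 → ∀ k, k ≠ 0 → k ≠ d → l (k - d) = 0 → l k = 0 := by
    intro d hd k hk0 hkd hz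
    by_contra hne
    refine hcon (h.commute_conj_of_mem (d := -d) (hneg' d hd) (h.mem (-k)) ?_ ?_ hne)
    · rw [dirSect_of_ne (fun h => hkd (neg_injective h).symm), neg_sub_neg, hz, modPow_zero]
    · rw [dirSect_of_ne (neg_ne_zero.2 hk0).symm, zero_sub, neg_neg]
  obtain ⟨r, h1, hgeo, hlast⟩ := geometric_of_minors hp h.zero h.exists_ne_zero hneg hM hZ
  have hr : r ≠ 1 := by
    rintro rfl
    obtain ⟨k, hk0, hk1, hk⟩ := h.step_ne
    exact hk (by rw [step, hgeo k hk0 hk1, one_mul, sub_self])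
  -- For a geometric l this combination cancels all coordinates but 0 and 1.
  let y : ZMod p → A := dirSect l a b 0 * dirSect l a b 1 ^ (-r).val
  have hyS : y ∈ S := S.mul_mem (h.mem 0) (S.pow_mem (h.mem 1) _)
  have hy : ∀ k, y k = dirSect l a b 0 k * modPow (dirSect l a b 1 k) (-r) := fun k => rfl
  have hy0 : y 0 = b * modPow a (- l 1) := by
    rw [hy, dirSect_self, dirSect_of_ne zero_ne_one, ← modPow_mul h.pow_a, zero_sub, hlast]
    congr 2; ring
  have hy1 : y 1 = modPow a (l 1) * modPow b (-r) := by
    rw [hy, dirSect_self, dirSect_of_ne one_ne_zero, sub_zero]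
  have hyk : ∀ k, k ≠ 0 → k ≠ 1 → y k = 1 := by
    intro k hk0 hk1
    rw [hy, dirSect_of_ne hk0, dirSect_of_ne hk1, ← modPow_mul h.pow_a, ← modPow_add h.pow_a,
      sub_zero, hgeo k hk0 hk1, ← modPow_zero (p := p) a]
    congr 1; ring
  -- The supports of y and its rotation, {0, 1} and {1, 2}, meet only in 1, since p is odd.
  have hmem : ⁅y 1, y 0⁆ ∈ rist ⁅S, S⁆ := by
    have hz := Subgroup.commutator_mem_commutator hyS (h.rot_S ⟨y, hyS, rfl⟩)
    have h12 : (1 : ZMod p) - 1 = 0 := sub_self 1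
    have hz1 : ⁅y, rot p A y⁆ 1 = ⁅y 1, y 0⁆ := by
      change ⁅y 1, y (1 - 1)⁆ = _
      rw [h12]
    rw [← hz1]
    have hone : ∀ k, k ≠ 1 → ⁅y, rot p A y⁆ k = 1 := by
      intro k hk1
      change ⁅y k, y (k - 1)⁆ = 1
      by_cases hk0 : k = 0
      · subst hk0
        rw [hyk (0 - 1), commutatorElement_one_right]
        · simp
        · rw [zero_sub]; exact (one_ne_neg_one hp).symm
      · rw [hyk k hk0 hk1, commutatorElement_one_left]
    refine mem_rist_of_mem (map_rot_commutator_le h.rot_S) hz one_ne_zero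
      (fun k hk _ => hone k hk) ?_
    rw [hone 0 zero_ne_one]
    exact one_mem _
  rw [hy0, hy1, ← commute_mk_iff] at hmem
  simp only [map_mul, map_modPow] at hmem
  exact hab (commute_of_commute_products (by rw [← map_pow, h.pow_a, map_one])
    (by rw [← map_pow, h.pow_b, map_one]) h1 hr hmem)

/-- `γ₃(A) × ⋯ × γ₃(A)` is contained in the derived subgroup of `S`. -/
theorem gamma3_le_rist_S (hp : p ≠ 2) :
    ⁅⁅(⊤ : Subgroup A), (⊤ : Subgroup A)⁆, (⊤ : Subgroup A)⁆ ≤ rist ⁅S, S⁆ := by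
  have hn := h.rist_S_normal
  have hqa : QuotientGroup.mk' (rist ⁅S, S⁆) a ^ p = 1 := by rw [← map_pow, h.pow_a, map_one]
  have hconj := h.commute_conj hp
  simp only [map_mul, map_inv] at hconj
  obtain ⟨d', hd'⟩ := h.exists_ne_zero
  obtain ⟨d, rfl⟩ : ∃ d, d' = -d := ⟨-d', (neg_neg _).symm⟩
  have hd0 : d ≠ 0 := by rintro rfl; rw [neg_zero, h.zero] at hd'; exact hd' rfl
  have hc := commute_commutator_modPow (p := p) hconj
  refine gamma3_le_of_generators h.closure_eq _ ?_ ?_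
  · rw [← commute_mk_iff, map_commutatorElement]
    simpa [modPow_one] using hc 1 1
  · rw [← commute_mk_iff, map_commutatorElement]
    refine commute_commutator_right hqa hconj hd' ?_
    -- Commuting with the tuple of b itself: at d its entry is a power of a, with which [a^k, b]
    -- already commutes, so the entry [[b, a^(l(-d))], b] at 0 is isolated.
    have h1 := h.commutator_mem_rist hd0 (h.commutator_dirSect_mem d)
      (fun k => commutator_dirSect_of_ne) (h.mem 0) (by
        rw [commutator_dirSect_right hd0, dirSect_of_ne hd0, ← commute_mk_iff,
          map_commutatorElement, map_modPow, map_modPow]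
        exact hc _ _)
    rw [commutator_dirSect_zero hd0, dirSect_self, ← commute_mk_iff, map_commutatorElement,
      map_modPow] at h1
    exact h1

end SectionGroups
end Sections
/-! ## The commutator pairing -/

section Pairing

open scoped commutatorElement

variable {p : ℕ} {A : Type*} [Group A] {K : Type*} [AddCommGroup K]
  {π : der (⊤ : Subgroup A) →* Multiplicative K}

/-- The class of the commutator `⁅x, y⁆`. -/
def pair (π : der (⊤ : Subgroup A) →* Multiplicative K) (x y : A) : K :=
  (π ⟨⁅x, y⁆, comm_mem (Subgroup.mem_top x) (Subgroup.mem_top y)⟩).toAdd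

theorem pair_swap (x y : A) : pair π x y = - pair π y x := by
  rw [eq_neg_iff_add_eq_zero, pair, pair, ← toAdd_mul, ← map_mul]
  have : (⟨⁅x, y⁆, comm_mem (Subgroup.mem_top x) (Subgroup.mem_top y)⟩ *
      ⟨⁅y, x⁆, comm_mem (Subgroup.mem_top y) (Subgroup.mem_top x)⟩ : der (⊤ : Subgroup A)) = 1 := by
    apply Subtype.ext
    change ⁅x, y⁆ * ⁅y, x⁆ = 1
    rw [← commutatorElement_inv y x, inv_mul_cancel]
  rw [this, map_one, toAdd_one]

/-- [x, yz] = [x, y] [y, [x, z]] [x, z], and the middle factor lies in γ₃. -/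
theorem pair_mul_right (hπ : ∀ z, π z = 1 ↔ (z : A) ∈ gamma3 (⊤ : Subgroup A)) (x y z : A) :
    pair π x (y * z) = pair π x y + pair π x z := by
  have h1 : ⁅y, ⁅x, z⁆⁆ ∈ gamma3 (⊤ : Subgroup A) := by
    rw [← commutatorElement_inv]
    exact inv_mem (Subgroup.commutator_mem_commutator
      (comm_mem (Subgroup.mem_top x) (Subgroup.mem_top z)) (Subgroup.mem_top y))
  have h2 : ⁅y, ⁅x, z⁆⁆ ∈ der (⊤ : Subgroup A) := comm_mem (Subgroup.mem_top _) (Subgroup.mem_top _)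
  have h3 : π ⟨_, h2⟩ = 1 := (hπ _).2 h1
  have e : (⟨⁅x, y * z⁆, comm_mem (Subgroup.mem_top x) (Subgroup.mem_top _)⟩ : der (⊤ : Subgroup A)) =
      ⟨⁅x, y⁆, comm_mem (Subgroup.mem_top x) (Subgroup.mem_top y)⟩ * (⟨_, h2⟩ *
        ⟨⁅x, z⁆, comm_mem (Subgroup.mem_top x) (Subgroup.mem_top z)⟩) := by
    apply Subtype.ext
    simp [commutatorElement_def, mul_assoc]
  rw [pair, e, map_mul π, map_mul π, h3, one_mul, toAdd_mul, pair, pair]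

theorem pair_mul_left (hπ : ∀ z, π z = 1 ↔ (z : A) ∈ gamma3 (⊤ : Subgroup A)) (x y z : A) :
    pair π (x * y) z = pair π x z + pair π y z := by
  rw [pair_swap, pair_mul_right hπ, pair_swap z x, pair_swap z y]; abel

theorem pair_one_left (hπ : ∀ z, π z = 1 ↔ (z : A) ∈ gamma3 (⊤ : Subgroup A)) (z : A) :
    pair π 1 z = 0 := by
  simpa using pair_mul_left hπ 1 1 z

theorem pair_inv_left (hπ : ∀ z, π z = 1 ↔ (z : A) ∈ gamma3 (⊤ : Subgroup A)) (x z : A) :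
    pair π x⁻¹ z = - pair π x z := by
  rw [eq_neg_iff_add_eq_zero, ← pair_mul_left hπ, inv_mul_cancel, pair_one_left hπ]

theorem pair_self (x : A) : pair π x x = 0 := by
  have : (⟨⁅x, x⁆, comm_mem (Subgroup.mem_top x) (Subgroup.mem_top x)⟩ : der (⊤ : Subgroup A)) = 1 :=
    Subtype.ext (commutatorElement_self x)
  rw [pair, this, map_one, toAdd_one]

theorem pair_conj_left (hπ : ∀ z, π z = 1 ↔ (z : A) ∈ gamma3 (⊤ : Subgroup A)) (s x z : A) :
    pair π (s * x * s⁻¹) z = pair π x z := by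
  rw [pair_mul_left hπ, pair_mul_left hπ, pair_inv_left hπ]; abel

variable [Module (ZMod p) K]

/-- The element `g` is `a ^ x * b ^ y` for the commutator pairing. -/
def HasCoord (π : der (⊤ : Subgroup A) →* Multiplicative K) (a b g : A) (x y : ZMod p) : Prop :=
  ∀ z, pair π g z = x • pair π a z + y • pair π b z

variable {a b g g' : A} {x y x' y' : ZMod p}

theorem HasCoord.mul (hπ : ∀ z, π z = 1 ↔ (z : A) ∈ gamma3 (⊤ : Subgroup A))
    (h : HasCoord π a b g x y) (h' : HasCoord π a b g' x' y') :
    HasCoord π a b (g * g') (x + x') (y + y') := by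
  intro z; rw [pair_mul_left hπ, h, h', add_smul, add_smul]; abel

theorem HasCoord.inv (hπ : ∀ z, π z = 1 ↔ (z : A) ∈ gamma3 (⊤ : Subgroup A))
    (h : HasCoord π a b g x y) : HasCoord π a b g⁻¹ (-x) (-y) := by
  intro z; rw [pair_inv_left hπ, h, neg_smul, neg_smul]; abel

theorem hasCoord_one (hπ : ∀ z, π z = 1 ↔ (z : A) ∈ gamma3 (⊤ : Subgroup A)) :
    HasCoord π a b 1 (0 : ZMod p) 0 := by
  intro z; rw [pair_one_left hπ, zero_smul, zero_smul, add_zero]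

theorem hasCoord_left : HasCoord π a b a (1 : ZMod p) 0 := by
  intro z; rw [one_smul, zero_smul, add_zero]

theorem hasCoord_right : HasCoord π a b b (0 : ZMod p) 1 := by
  intro z; rw [one_smul, zero_smul, zero_add]

theorem hasCoord_modPow [NeZero p] (hπ : ∀ z, π z = 1 ↔ (z : A) ∈ gamma3 (⊤ : Subgroup A))
    (t : ZMod p) : HasCoord π a b (modPow a t) t 0 := by
  have : ∀ n : ℕ, HasCoord π a b (a ^ n) (n : ZMod p) 0 := by
    intro n
    induction n with
    | zero => simpa using hasCoord_one hπ
    | succ n ih => simpa [pow_succ] using ih.mul hπ hasCoord_left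
  have h := this t.val
  rwa [ZMod.natCast_zmod_val] at h

/-- The pairing is alternating and bilinear, hence the determinant of the exponents of a and b.
Uniqueness of these exponents is not needed. -/
theorem HasCoord.pair_eq (h : HasCoord π a b g x y) (h' : HasCoord π a b g' x' y') :
    pair π g g' = (x * y' - y * x') • pair π a b := by
  rw [h, pair_swap a, pair_swap b, h', h', pair_self, pair_self, pair_swap b a]
  module

theorem exists_hasCoord (hπ : ∀ z, π z = 1 ↔ (z : A) ∈ gamma3 (⊤ : Subgroup A))
    (hab : Subgroup.closure {a, b} = ⊤) (g : A) : ∃ x y : ZMod p, HasCoord π a b g x y := by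
  have hg : g ∈ Subgroup.closure {a, b} := hab ▸ Subgroup.mem_top g
  induction hg using Subgroup.closure_induction with
  | mem s hs =>
    rcases hs with rfl | rfl
    · exact ⟨1, 0, hasCoord_left⟩
    · exact ⟨0, 1, hasCoord_right⟩
  | one => exact ⟨0, 0, hasCoord_one hπ⟩
  | mul u v _ _ hu hv =>
    obtain ⟨x, y, h⟩ := hu
    obtain ⟨x', y', h'⟩ := hv
    exact ⟨_, _, h.mul hπ h'⟩
  | inv u _ hu =>
    obtain ⟨x, y, h⟩ := hu
    exact ⟨_, _, h.inv hπ⟩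

/-- The quotient of the derived subgroup is spanned by the class of `⁅a, b⁆`. -/
theorem exists_eq_smul_pair (hπ : ∀ z, π z = 1 ↔ (z : A) ∈ gamma3 (⊤ : Subgroup A))
    (hs : Function.Surjective π)
    (hab : Subgroup.closure {a, b} = ⊤) (v : K) : ∃ t : ZMod p, v = t • pair π a b := by
  obtain ⟨⟨g, hg⟩, hz⟩ := hs (Multiplicative.ofAdd v)
  suffices ∀ g (hg : g ∈ der (⊤ : Subgroup A)), (π ⟨g, hg⟩).toAdd ∈ Submodule.span (ZMod p) {pair π a b} by
    have h := this g hg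
    rw [hz, toAdd_ofAdd, Submodule.mem_span_singleton] at h
    exact h.imp fun _ h => h.symm
  clear! g
  intro g hg
  have hg' : g ∈ Subgroup.closure {g | ∃ g₁ ∈ (⊤ : Subgroup A), ∃ g₂ ∈ (⊤ : Subgroup A), ⁅g₁, g₂⁆ = g} := hg
  induction hg' using Subgroup.closure_induction with
  | mem s hs =>
    obtain ⟨x, -, y, -, rfl⟩ := hs
    obtain ⟨_, _, h⟩ := exists_hasCoord (p := p) hπ hab x
    obtain ⟨_, _, h'⟩ := exists_hasCoord (p := p) hπ hab y
    change pair π x y ∈ _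
    rw [h.pair_eq h']
    exact Submodule.smul_mem _ _ (Submodule.mem_span_singleton_self _)
  | one =>
    have : (⟨1, hg⟩ : der (⊤ : Subgroup A)) = 1 := rfl
    rw [this, map_one, toAdd_one]; exact Submodule.zero_mem _
  | mul u v hu hv ihu ihv =>
    have : (⟨u * v, hg⟩ : der (⊤ : Subgroup A)) = ⟨u, hu⟩ * ⟨v, hv⟩ := rfl
    rw [this, map_mul, toAdd_mul]; exact Submodule.add_mem _ (ihu hu) (ihv hv)
  | inv u hu ihu =>
    have : (⟨u⁻¹, hg⟩ : der (⊤ : Subgroup A)) = ⟨u, hu⟩⁻¹ := rfl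
    rw [this, map_inv, toAdd_inv]; exact Submodule.neg_mem _ (ihu hu)

end Pairing

/-! ## Images in `V` -/

section Image

open scoped commutatorElement

variable {p : ℕ} {A : Type*} [Group A] {K : Type*} [AddCommGroup K]

/-- The tuple of classes of a tuple of elements of the derived subgroup. -/
def classes (π : der (⊤ : Subgroup A) →* Multiplicative K) (g : ZMod p → A)
    (hg : ∀ k, g k ∈ der (⊤ : Subgroup A)) : ZMod p → K :=
  fun k => (π ⟨g k, hg k⟩).toAdd

variable {π : der (⊤ : Subgroup A) →* Multiplicative K}

theorem classes_mul {g g' : ZMod p → A} (hg : ∀ k, g k ∈ der (⊤ : Subgroup A))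
    (hg' : ∀ k, g' k ∈ der (⊤ : Subgroup A)) :
    classes π (g * g') (fun k => mul_mem (hg k) (hg' k)) = classes π g hg + classes π g' hg' := by
  funext k
  have : (⟨g k * g' k, mul_mem (hg k) (hg' k)⟩ : der (⊤ : Subgroup A)) = ⟨g k, hg k⟩ * ⟨g' k, hg' k⟩ := rfl
  change (π ⟨g k * g' k, _⟩).toAdd = _
  rw [this, map_mul, toAdd_mul]; rfl

theorem classes_inv {g : ZMod p → A} (hg : ∀ k, g k ∈ der (⊤ : Subgroup A)) :
    classes π g⁻¹ (fun k => inv_mem (hg k)) = - classes π g hg := by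
  funext k
  have : (⟨(g k)⁻¹, inv_mem (hg k)⟩ : der (⊤ : Subgroup A)) = ⟨g k, hg k⟩⁻¹ := rfl
  change (π ⟨(g k)⁻¹, _⟩).toAdd = _
  rw [this, map_inv, toAdd_inv]; rfl

theorem classes_one : classes π (1 : ZMod p → A) (fun _ => one_mem _) = 0 := by
  funext k
  have : (⟨1, one_mem _⟩ : der (⊤ : Subgroup A)) = 1 := rfl
  change (π ⟨1, _⟩).toAdd = 0
  rw [this, map_one, toAdd_one]

variable [Module (ZMod p) K]

/-- The image in `V` of the tuples in `H` with entries in the derived subgroup. -/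
def image (π : der (⊤ : Subgroup A) →* Multiplicative K) (H : Subgroup (ZMod p → A)) :
    Submodule (ZMod p) (ZMod p → K) :=
  AddSubgroup.toZModSubmodule p
    { carrier := {v | ∃ g ∈ H, ∃ hg, classes π g hg = v}
      zero_mem' := ⟨1, H.one_mem, _, classes_one⟩
      add_mem' := by
        rintro _ _ ⟨g, hgH, hg, rfl⟩ ⟨g', hgH', hg', rfl⟩
        exact ⟨g * g', H.mul_mem hgH hgH', _, classes_mul hg hg'⟩
      neg_mem' := by
        rintro _ ⟨g, hgH, hg, rfl⟩
        exact ⟨g⁻¹, H.inv_mem hgH, _, classes_inv hg⟩ }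

theorem mem_image {H : Subgroup (ZMod p → A)} {v : ZMod p → K} :
    v ∈ image π H ↔ ∃ g ∈ H, ∃ hg, classes π g hg = v := Iff.rfl

theorem cycShift_mem_image {H : Subgroup (ZMod p → A)} (hH : H.map (rot p A) ≤ H) (v : ZMod p → K)
    (hv : v ∈ image π H) : cycShift p K v ∈ image π H := by
  obtain ⟨g, hgH, hg, rfl⟩ := mem_image.1 hv
  exact mem_image.2 ⟨rot p A g, hH ⟨g, hgH, rfl⟩, fun k => hg (k - 1), rfl⟩

/-- A rotation-invariant H containing all tuples over γ₃ is determined, among tuples over the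
derived subgroup, by its image in V. -/
theorem mem_of_classes_mem_image [NeZero p] (hπ : ∀ z, π z = 1 ↔ (z : A) ∈ gamma3 (⊤ : Subgroup A))
    {H : Subgroup (ZMod p → A)} (hH : H.map (rot p A) ≤ H) (hγ : gamma3 (⊤ : Subgroup A) ≤ rist H)
    {g : ZMod p → A} (hg : ∀ k, g k ∈ der (⊤ : Subgroup A)) (h : classes π g hg ∈ image π H) :
    g ∈ H := by
  obtain ⟨g', hgH', hg', h'⟩ := mem_image.1 h
  have h1 : g * g'⁻¹ ∈ H := by
    refine pi_le_of_le_rist hH hγ fun k => ?_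
    have h2 : π (⟨g k, hg k⟩ * ⟨g' k, hg' k⟩⁻¹) = 1 := by
      rw [map_mul, map_inv, mul_inv_eq_one]
      exact (congrFun h' k).symm
    exact (hπ _).1 h2
  have := H.mul_mem h1 hgH'
  rwa [inv_mul_cancel_right] at this

/-- The tuple of commutator pairings. -/
def pairs (π : der (⊤ : Subgroup A) →* Multiplicative K) (g g' : ZMod p → A) : ZMod p → K :=
  fun k => pair π (g k) (g' k)

theorem pairs_mem_image {H : Subgroup (ZMod p → A)} {g g' : ZMod p → A} (hg : g ∈ H) (hg' : g' ∈ H) :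
    pairs π g g' ∈ image π ⁅H, H⁆ :=
  mem_image.2 ⟨⁅g, g'⁆, Subgroup.commutator_mem_commutator hg hg',
    fun _ => comm_mem (Subgroup.mem_top _) (Subgroup.mem_top _), rfl⟩

theorem mem_der_of_mem_commutator {H : Subgroup (ZMod p → A)} {g : ZMod p → A} (hg : g ∈ ⁅H, H⁆)
    (k : ZMod p) : g k ∈ der (⊤ : Subgroup A) := by
  have : ⁅H, H⁆ ≤ (der (⊤ : Subgroup A)).comap (Pi.evalMonoidHom (fun _ : ZMod p => A) k) := by
    rw [Subgroup.commutator_le]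
    exact fun x _ y _ => comm_mem (Subgroup.mem_top (x k)) (Subgroup.mem_top (y k))
  exact this hg

theorem image_commutator_le {H : Subgroup (ZMod p → A)} {W : Submodule (ZMod p) (ZMod p → K)}
    (hW : ∀ g ∈ H, ∀ g' ∈ H, pairs π g g' ∈ W) : image π ⁅H, H⁆ ≤ W := by
  rintro _ ⟨g, hgH, hg, rfl⟩
  have hg' : g ∈ Subgroup.closure {g | ∃ g₁ ∈ H, ∃ g₂ ∈ H, ⁅g₁, g₂⁆ = g} := hgH
  clear hgH
  induction hg' using Subgroup.closure_induction with
  | mem s hs =>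
    obtain ⟨x, hx, y, hy, rfl⟩ := hs
    exact hW x hx y hy
  | one => rw [classes_one]; exact W.zero_mem
  | mul u v hu hv ihu ihv =>
    rw [classes_mul (mem_der_of_mem_commutator hu) (mem_der_of_mem_commutator hv)]
    exact W.add_mem (ihu _) (ihv _)
  | inv u hu ihu =>
    rw [classes_inv (mem_der_of_mem_commutator hu)]
    exact W.neg_mem (ihu _)

end Image

/-! ### The commutator subgroups of S and D modulo γ₃ -/

section Main

open scoped commutatorElement

variable {p : ℕ} {A : Type*} [Group A] {K : Type*} [AddCommGroup K] [Module (ZMod p) K]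
  {π : der (⊤ : Subgroup A) →* Multiplicative K}
  {l : ZMod p → ZMod p} {a b : A} {S D : Subgroup (ZMod p → A)}

theorem hasCoord_dirSect [NeZero p] (hπ : ∀ z, π z = 1 ↔ (z : A) ∈ gamma3 (⊤ : Subgroup A))
    (hl : l 0 = 0) (i k : ZMod p) :
    HasCoord π a b (dirSect l a b i k) (l (k - i)) (if k = i then 1 else 0) := by
  by_cases h : k = i
  · subst h
    rw [dirSect_self, if_pos rfl, sub_self, hl]
    exact hasCoord_right
  · rw [dirSect_of_ne h, if_neg h]
    exact hasCoord_modPow hπ _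

theorem hasCoord_dirQuot [NeZero p] (hπ : ∀ z, π z = 1 ↔ (z : A) ∈ gamma3 (⊤ : Subgroup A))
    (hl : l 0 = 0) (i k : ZMod p) :
    HasCoord π a b (dirQuot l a b i k) (step l (k - i))
      ((if k = i then 1 else 0) - (if k = i + 1 then 1 else 0)) := by
  have := (hasCoord_dirSect (a := a) (b := b) hπ hl i k).mul hπ
    ((hasCoord_dirSect (a := a) (b := b) hπ hl (i + 1) k).inv hπ)
  rwa [← sub_eq_add_neg, ← sub_eq_add_neg, ← sub_sub] at this

namespace SectionGroups

variable [Fact p.Prime]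

/-- Disposes of the degenerate case V = 0, so that non-triviality of G'/γ₃(G) never has to be
established. -/
theorem subsingleton_of_pair_eq_zero (h : SectionGroups l a b S D)
    (hπ : ∀ z, π z = 1 ↔ (z : A) ∈ gamma3 (⊤ : Subgroup A))
    (hs : Function.Surjective π) (h0 : pair π a b = 0) (v : ZMod p → K) : v = 0 := by
  funext k
  obtain ⟨t, ht⟩ := exists_eq_smul_pair (p := p) hπ hs h.closure_eq (v k)
  rw [ht, h0, smul_zero]; rfl

theorem pairs_dirSect (h : SectionGroups l a b S D) (hπ : ∀ z, π z = 1 ↔ (z : A) ∈ gamma3 (⊤ : Subgroup A)) (d : ZMod p) :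
    pairs π (dirSect l a b 0) (dirSect l a b d) = fun k =>
      (l k * (if k = d then 1 else 0) - (if k = 0 then 1 else 0) * l (k - d)) • pair π a b := by
  funext k
  have := (hasCoord_dirSect (a := a) (b := b) hπ h.zero 0 k).pair_eq
    (hasCoord_dirSect (a := a) (b := b) hπ h.zero d k)
  rwa [sub_zero] at this

/-- If `l` is not symmetric, the derived subgroup of `S` has full image in `V`. -/
theorem mem_image_S_of_not_symm (h : SectionGroups l a b S D)
    (hπ : ∀ z, π z = 1 ↔ (z : A) ∈ gamma3 (⊤ : Subgroup A)) (hs : Function.Surjective π)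
    {d : ZMod p} (hd : l d ≠ l (-d)) (v : ZMod p → K) : v ∈ image π ⁅S, S⁆ := by
  by_cases h0 : pair π a b = 0
  · rw [h.subsingleton_of_pair_eq_zero hπ hs h0 v]; exact Submodule.zero_mem _
  refine mem_of_sum_ne_zero (exists_eq_smul_pair (p := p) hπ hs h.closure_eq)
    (cycShift_mem_image (map_rot_commutator_le h.rot_S))
    (pairs_mem_image (h.mem 0) (h.mem d)) ?_ v
  -- The sum of the coordinates is l d - l (-d) times the class of [a, b].
  rw [h.pairs_dirSect hπ, ← Finset.sum_smul]
  refine smul_ne_zero ?_ h0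
  simpa [Finset.sum_sub_distrib] using sub_ne_zero.2 hd

/-- If `l` is symmetric, the image in `V` of the derived subgroup of `S` contains all tuples with
sum zero. -/
theorem mem_image_S_of_symm (h : SectionGroups l a b S D)
    (hπ : ∀ z, π z = 1 ↔ (z : A) ∈ gamma3 (⊤ : Subgroup A)) (hs : Function.Surjective π)
    (hl : ∀ d, l d = l (-d)) {v : ZMod p → K} (hv : ∑ k, v k = 0) : v ∈ image π ⁅S, S⁆ := by
  by_cases h0 : pair π a b = 0
  · rw [h.subsingleton_of_pair_eq_zero hπ hs h0 v]; exact Submodule.zero_mem _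
  obtain ⟨d, hd⟩ := h.exists_ne_zero
  have hd0 : d ≠ 0 := by rintro rfl; exact hd h.zero
  refine mem_of_moment_ne_zero (exists_eq_smul_pair (p := p) hπ hs h.closure_eq)
    (cycShift_mem_image (map_rot_commutator_le h.rot_S))
    (pairs_mem_image (h.mem 0) (h.mem d)) ?_ ?_ hv
  · rw [h.pairs_dirSect hπ, ← Finset.sum_smul]
    simp [Finset.sum_sub_distrib, ← hl d]
  -- The weight kills the entry at 0, so the first moment has coefficient d · l d.
  · simp only [h.pairs_dirSect hπ, smul_smul]
    rw [← Finset.sum_smul]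
    refine smul_ne_zero ?_ h0
    simp [mul_sub, Finset.sum_sub_distrib, hd0, hd]

/-- If l is not even, D contains every tuple over the derived subgroup, and commuting tuples
supported at 0 with D is enough. If l is even, D still contains c at one place and c⁻¹ at another,
and the neighbouring quotient has a trivial entry against which one of the two can be hidden. -/
theorem gamma3_le_rist_D (h : SectionGroups l a b S D) (hp : p ≠ 2)
    (hπ : ∀ z, π z = 1 ↔ (z : A) ∈ gamma3 (⊤ : Subgroup A)) (hs : Function.Surjective π) :
    gamma3 (⊤ : Subgroup A) ≤ rist ⁅D, D⁆ := by
  have hγ : gamma3 (⊤ : Subgroup A) ≤ rist ⁅S, S⁆ := h.gamma3_le_rist_S hp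
  have hrot := map_rot_commutator_le h.rot_S
  by_cases hl : ∀ d, l d = l (-d)
  · have hn := h.rist_D_normal
    let c : A := ⁅a, b⁆
    have hc : c ∈ der (⊤ : Subgroup A) := comm_mem (Subgroup.mem_top _) (Subgroup.mem_top _)
    have hy : ∀ i j : ZMod p, i ≠ j →
        -- The classes of this tuple have sum zero, and [S, S] contains all tuples over γ₃.
        (Pi.mulSingle i c * Pi.mulSingle j c⁻¹ : ZMod p → A) ∈ ⁅S, S⁆ := by
      intro i j hij
      have hi : ∀ k, (Pi.mulSingle i c : ZMod p → A) k ∈ der (⊤ : Subgroup A) := by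
        intro k
        by_cases hk : k = i
        · subst hk; simpa using hc
        · rw [Pi.mulSingle_eq_of_ne hk]; exact one_mem _
      have hj : ∀ k, (Pi.mulSingle j c⁻¹ : ZMod p → A) k ∈ der (⊤ : Subgroup A) := by
        intro k
        by_cases hk : k = j
        · subst hk; simpa using hc
        · rw [Pi.mulSingle_eq_of_ne hk]; exact one_mem _
      have hsum : ∀ (i : ZMod p) (c : A) (hc : c ∈ der (⊤ : Subgroup A))
          (hi : ∀ k, (Pi.mulSingle i c : ZMod p → A) k ∈ der (⊤ : Subgroup A)),
          ∑ k, classes π (Pi.mulSingle i c) hi k = (π ⟨c, hc⟩).toAdd := by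
        intro i c hc hi
        rw [Finset.sum_eq_single i]
        · simp [classes]
        · intro k _ hk
          have : (⟨(Pi.mulSingle i c : ZMod p → A) k, hi k⟩ : der (⊤ : Subgroup A)) = 1 :=
            Subtype.ext (Pi.mulSingle_eq_of_ne hk _)
          rw [classes, this, map_one, toAdd_one]
        · simp
      refine mem_of_classes_mem_image hπ hrot hγ (fun k => mul_mem (hi k) (hj k)) ?_
      refine h.mem_image_S_of_symm hπ hs hl ?_
      rw [classes_mul hi hj]
      simp only [Pi.add_apply, Finset.sum_add_distrib]
      rw [hsum i c hc hi, hsum j c⁻¹ (inv_mem hc) hj, ← toAdd_mul, ← map_mul]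
      have : (⟨c, hc⟩ * ⟨c⁻¹, inv_mem hc⟩ : der (⊤ : Subgroup A)) = 1 :=
        Subtype.ext (mul_inv_cancel c)
      rw [this, map_one, toAdd_one]
    have h2 := two_ne_zero' hp
    -- With t = 1/2 one has t - 1 = -t, so evenness of l makes the entry of the neighbouring
    -- quotient at t trivial.
    obtain ⟨t, ht⟩ : ∃ t : ZMod p, 2 * t = 1 := ⟨2⁻¹, mul_inv_cancel₀ h2⟩
    have ht0 : t ≠ 0 := by rintro rfl; simp at ht
    have ht1 : t ≠ 1 := by
      rintro rfl
      exact one_ne_zero (α := ZMod p) (by linear_combination ht)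
    have hst : step l t = 0 := by
      rw [step, hl t, sub_eq_zero]; congr 1; linear_combination -ht
    have hqt : dirQuot l a b 0 t = 1 := by
      rw [h.dirQuot_apply_of_ne ht0 (by simpa using ht1), sub_zero, hst, modPow_zero]
    have key : ∀ d, d ≠ t → ⁅dirQuot l a b 0 d, c⁆ ∈ rist ⁅D, D⁆ := by
      intro d hd
      have hz := Subgroup.commutator_mem_commutator (h.quot_mem 0) (h.comm_le (hy d t hd))
      have hzd : ⁅dirQuot l a b 0, (Pi.mulSingle d c * Pi.mulSingle t c⁻¹ : ZMod p → A)⁆ d =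
          ⁅dirQuot l a b 0 d, c⁆ := by
        change ⁅dirQuot l a b 0 d,
          (Pi.mulSingle d c : ZMod p → A) d * (Pi.mulSingle t c⁻¹ : ZMod p → A) d⁆ = _
        rw [Pi.mulSingle_eq_same, Pi.mulSingle_eq_of_ne hd, mul_one]
      rw [← hzd]
      refine mem_rist_of_mem (map_rot_commutator_le h.rot_D) hz hd (fun k hk hk' => ?_) ?_
      · change ⁅dirQuot l a b 0 k,
          (Pi.mulSingle d c : ZMod p → A) k * (Pi.mulSingle t c⁻¹ : ZMod p → A) k⁆ = _
        rw [Pi.mulSingle_eq_of_ne hk, Pi.mulSingle_eq_of_ne hk', mul_one, commutatorElement_one_right]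
      · change ⁅dirQuot l a b 0 t, _⁆ ∈ _
        rw [hqt, commutatorElement_one_left]
        exact one_mem _
    obtain ⟨d, hd0, hd1, hd⟩ := h.step_ne
    have hqa : QuotientGroup.mk' (rist ⁅D, D⁆) a ^ p = 1 := by rw [← map_pow, h.pow_a, map_one]
    have hca : Commute (QuotientGroup.mk' (rist ⁅D, D⁆) a) (QuotientGroup.mk' (rist ⁅D, D⁆) c) := by
      have h1 := key d (by rintro rfl; exact hd hst)
      rw [h.dirQuot_apply_of_ne hd0 (by simpa using hd1), sub_zero, ← commute_mk_iff, map_modPow] at h1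
      exact commute_of_modPow hqa hd h1
    have hcb : Commute (QuotientGroup.mk' (rist ⁅D, D⁆) b) (QuotientGroup.mk' (rist ⁅D, D⁆) c) := by
      have h1 := key 0 ht0.symm
      rw [h.dirQuot_apply_zero, ← commute_mk_iff, map_mul, map_modPow] at h1
      have h3 := h1.mul_left ((hca.pow_left (-l (-1)).val).inv_left)
      rwa [modPow, mul_inv_cancel_right] at h3
    exact gamma3_le_of_generators h.closure_eq _ ((commute_mk_iff _ _ _).1 hca.symm)
      ((commute_mk_iff _ _ _).1 hcb.symm)
  · push Not at hl
    obtain ⟨d, hd⟩ := hl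
    refine Subgroup.commutator_le.2 fun g hg x _ => ?_
    -- Any x is the coordinate 0 of some s in D; commuting s with g placed at 0 leaves [g, x] at 0
    -- and nothing elsewhere.
    obtain ⟨s, hsD, rfl⟩ := h.exists_mem_D x
    have hk : ∀ k, (Pi.mulSingle 0 g : ZMod p → A) k ∈ der (⊤ : Subgroup A) := by
      intro k
      by_cases hk : k = 0
      · subst hk; rwa [Pi.mulSingle_eq_same]
      · rw [Pi.mulSingle_eq_of_ne hk]; exact one_mem _
    have hmem : (Pi.mulSingle 0 g : ZMod p → A) ∈ D :=
      h.comm_le (mem_of_classes_mem_image hπ hrot hγ hk (h.mem_image_S_of_not_symm hπ hs hd _))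
    have hz := Subgroup.commutator_mem_commutator hmem hsD
    rw [mem_rist]
    convert hz using 1
    funext k
    by_cases hk : k = 0
    · subst hk
      change _ = ⁅(Pi.mulSingle 0 g : ZMod p → A) 0, s 0⁆
      simp
    · change _ = ⁅(Pi.mulSingle 0 g : ZMod p → A) k, s k⁆
      rw [Pi.mulSingle_eq_of_ne hk, Pi.mulSingle_eq_of_ne hk, commutatorElement_one_left]

/-! ## The image of the second derived subgroup -/

theorem pairs_dirQuot (h : SectionGroups l a b S D)
    (hπ : ∀ z, π z = 1 ↔ (z : A) ∈ gamma3 (⊤ : Subgroup A)) (i j : ZMod p) :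
    pairs π (dirQuot l a b i) (dirQuot l a b j) = fun k =>
      (step l (k - i) * ((if k = j then 1 else 0) - (if k = j + 1 then 1 else 0)) -
        ((if k = i then 1 else 0) - (if k = i + 1 then 1 else 0)) * step l (k - j)) • pair π a b := by
  funext k
  exact (hasCoord_dirQuot (a := a) (b := b) hπ h.zero i k).pair_eq
    (hasCoord_dirQuot (a := a) (b := b) hπ h.zero j k)

/-- This is the invariant that detects the symmetry of e''. -/
theorem sum_pairs_dirQuot (h : SectionGroups l a b S D)
    (hπ : ∀ z, π z = 1 ↔ (z : A) ∈ gamma3 (⊤ : Subgroup A)) (i j : ZMod p) :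
    ∑ k, pairs π (dirQuot l a b i) (dirQuot l a b j) k =
      (step₂ l (j - i) - step₂ l (-(j - i))) • pair π a b := by
  rw [h.pairs_dirQuot hπ, ← Finset.sum_smul]
  congr 1
  simp only [mul_sub, sub_mul, Finset.sum_sub_distrib, mul_ite, ite_mul, mul_one, one_mul, mul_zero,
    zero_mul, Finset.sum_ite_eq', Finset.mem_univ, if_true, step₂, neg_sub]
  rw [sub_add_eq_add_sub j, sub_add_eq_add_sub i]

/-- Once the sums vanish, the term with the factor i drops out, and the rest depends only on j - i;
it detects whether e' is constant. -/
theorem moment_pairs_dirQuot (h : SectionGroups l a b S D)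
    (hπ : ∀ z, π z = 1 ↔ (z : A) ∈ gamma3 (⊤ : Subgroup A)) (i j : ZMod p) :
    ∑ k : ZMod p, k • pairs π (dirQuot l a b i) (dirQuot l a b j) k =
      (i * (step₂ l (j - i) - step₂ l (-(j - i))) + ((j - i) * step l (j - i) -
        (j - i + 1) * step l (j - i + 1) + step l (1 - (j - i)))) • pair π a b := by
  simp only [h.pairs_dirQuot hπ, smul_smul]
  rw [← Finset.sum_smul]
  congr 1
  simp only [mul_sub, sub_mul, Finset.sum_sub_distrib, mul_ite, ite_mul, mul_one, one_mul, mul_zero,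
    zero_mul, Finset.sum_ite_eq', Finset.mem_univ, if_true, step₂, neg_sub]
  rw [show j + 1 - i = j - i + 1 by ring, show i + 1 - j = i - j + 1 by ring,
    show 1 - (j - i) = i - j + 1 by ring]
  ring

/-- The pairing does not see conjugation, so the S-conjugates generating D may be replaced by the
quotients themselves. -/
theorem pairs_mem_of_generators (h : SectionGroups l a b S D)
    (hπ : ∀ z, π z = 1 ↔ (z : A) ∈ gamma3 (⊤ : Subgroup A)) {W : Submodule (ZMod p) (ZMod p → K)}
    {y : ZMod p → A} (hW : ∀ i, pairs π (dirQuot l a b i) y ∈ W) {x : ZMod p → A} (hx : x ∈ D) :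
    pairs π x y ∈ W := by
  have hx' := h.le_closure hx
  clear hx
  induction hx' using Subgroup.closure_induction with
  | mem x hx =>
    obtain ⟨s, -, i, rfl⟩ := hx
    have : pairs π (s * dirQuot l a b i * s⁻¹) y = pairs π (dirQuot l a b i) y :=
      funext fun k => pair_conj_left hπ (s k) _ _
    rw [this]
    exact hW i
  | one =>
    have : pairs π 1 y = 0 := funext fun k => pair_one_left hπ _
    rw [this]; exact W.zero_mem
  | mul u v _ _ hu hv =>
    have : pairs π (u * v) y = pairs π u y + pairs π v y :=
      funext fun k => pair_mul_left hπ _ _ _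
    rw [this]; exact W.add_mem hu hv
  | inv u _ hu =>
    have : pairs π u⁻¹ y = - pairs π u y := funext fun k => pair_inv_left hπ _ _
    rw [this]; exact W.neg_mem hu

theorem image_D_le (h : SectionGroups l a b S D)
    (hπ : ∀ z, π z = 1 ↔ (z : A) ∈ gamma3 (⊤ : Subgroup A)) {W : Submodule (ZMod p) (ZMod p → K)}
    (hW : ∀ i j, pairs π (dirQuot l a b i) (dirQuot l a b j) ∈ W) : image π ⁅D, D⁆ ≤ W := by
  have hswap : ∀ x y : ZMod p → A, pairs π x y ∈ W → pairs π y x ∈ W := by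
    intro x y hxy
    have : pairs π y x = - pairs π x y := funext fun k => pair_swap _ _
    rw [this]; exact W.neg_mem hxy
  exact image_commutator_le fun x hx y hy => h.pairs_mem_of_generators hπ
    (fun i => hswap _ _ (h.pairs_mem_of_generators hπ (fun j => hW j i) hy)) hx

/-- The entries at 0, 1, 2 have coefficients -m, 2m, -m, the middle one because the two exceptional
steps at 0 and 1 add up to 2m. -/
theorem pairs_dirQuot_zero_one (h : SectionGroups l a b S D) (hp : p ≠ 2)
    (hπ : ∀ z, π z = 1 ↔ (z : A) ∈ gamma3 (⊤ : Subgroup A)) {m : ZMod p}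
    (hm : ∀ k, k ≠ 0 → k ≠ 1 → step l k = m) :
    pairs π (dirQuot l a b 0) (dirQuot l a b 1) =
      cycDiff p K (cycDiff p K (Pi.single 0 (-m • pair π a b))) := by
  have h2 := two_ne_zero' hp
  have h21 : (2 : ZMod p) ≠ 1 := fun h => one_ne_zero (α := ZMod p) (by linear_combination h)
  have h01 := step_add_step hm
  have hs : ∀ k : ZMod p, (Pi.single 0 (-m • pair π a b) : ZMod p → K) k =
      (if k = 0 then -m else 0) • pair π a b := by
    intro k
    by_cases hk : k = 0
    · subst hk; simp
    · simp [hk]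
  rw [h.pairs_dirQuot hπ]
  funext k
  simp only [cycDiff_apply, hs, ← sub_smul]
  congr 1
  rw [sub_zero, zero_add, one_add_one_eq_two, show k - 1 - 1 = k - 2 by ring]
  by_cases hk0 : k = 0
  · subst hk0
    rw [zero_sub, hm (-1) (by simp) (one_ne_neg_one hp).symm]
    simp [h2.symm, h2]
  by_cases hk1 : k = 1
  · subst hk1
    have : (1 : ZMod p) - 2 ≠ 0 := sub_ne_zero.2 h21.symm
    simp [h21.symm, this]
    linear_combination h01
  by_cases hk2 : k = 2
  · subst hk2
    have : (2 : ZMod p) - 1 ≠ 0 := sub_ne_zero.2 h21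
    rw [hm 2 h2 h21]
    simp [h21, this, h2]
  · simp [hk0, hk1, hk2, sub_ne_zero.2 hk1, sub_ne_zero.2 hk2]

open Classical in
/-- The image of the second derived subgroup in `V`. -/
theorem mem_image_D_iff (h : SectionGroups l a b S D) (hp : p ≠ 2)
    (hπ : ∀ z, π z = 1 ↔ (z : A) ∈ gamma3 (⊤ : Subgroup A)) (hs : Function.Surjective π)
    (v : ZMod p → K) : v ∈ image π ⁅D, D⁆ ↔
      (cycDiff p K ^ (p - ((if ∃ m, ∀ k, k ≠ 0 → k ≠ 1 → step l k = m then 1 else 0) +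
        (if ∀ k, step₂ l k = step₂ l (-k) then 1 else 0)))) v = 0 := by
  by_cases h0 : pair π a b = 0
  · rw [h.subsingleton_of_pair_eq_zero hπ hs h0 v, map_zero]
    exact ⟨fun _ => rfl, fun _ => Submodule.zero_mem _⟩
  have hspan := exists_eq_smul_pair (p := p) hπ hs h.closure_eq
  have hrot := cycShift_mem_image (π := π) (map_rot_commutator_le h.rot_D)
  have hpairs : ∀ i j, pairs π (dirQuot l a b i) (dirQuot l a b j) ∈ image π ⁅D, D⁆ :=
    fun i j => pairs_mem_image (h.quot_mem i) (h.quot_mem j)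
  by_cases hsym : ∀ k, step₂ l k = step₂ l (-k)
  · have hsum : ∀ i j, ∑ k, pairs π (dirQuot l a b i) (dirQuot l a b j) k = 0 := by
      intro i j
      rw [h.sum_pairs_dirQuot hπ, hsym, sub_self, zero_smul]
    by_cases hcon : ∃ m, ∀ k, k ≠ 0 → k ≠ 1 → step l k = m
    · rw [if_pos hsym, if_pos hcon]
      obtain ⟨m, hm⟩ := hcon
      constructor
      · refine fun hv => h.image_D_le hπ (W := LinearMap.ker (cycDiff p K ^ (p - (1 + 1)))) ?_ hv
        intro i j
        rw [LinearMap.mem_ker, cycDiff_pow_sub_two_eq_zero_iff]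
        refine ⟨hsum i j, ?_⟩
        rw [h.moment_pairs_dirQuot hπ, moment_eq_zero_of_const hp hm, hsym, sub_self, mul_zero,
          add_zero, zero_smul]
      · intro hv
        obtain ⟨hv0, hv1⟩ := (cycDiff_pow_sub_two_eq_zero_iff v).1 hv
        -- Here non-constancy of e enters: m = 0 would make all its differences vanish.
        have hm0 : m ≠ 0 := by
          rintro rfl
          obtain ⟨k, hk0, hk1, hk⟩ := h.step_ne
          exact hk (hm k hk0 hk1)
        refine mem_of_second_diff_mem hp hspan hrot (h.pairs_dirQuot_zero_one hp hπ hm ▸ hpairs 0 1) ?_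
          hv0 hv1
        rw [Finset.sum_pi_single']
        simpa using ⟨hm0, h0⟩
    · rw [if_pos hsym, if_neg hcon, zero_add, cycDiff_pow_sub_one_eq_zero_iff]
      constructor
      · intro hv
        rw [← cycDiff_pow_sub_one_eq_zero_iff]
        refine h.image_D_le hπ (W := LinearMap.ker (cycDiff p K ^ (p - 1))) (fun i j => ?_) hv
        rw [LinearMap.mem_ker, cycDiff_pow_sub_one_eq_zero_iff, hsum]
      · intro hv
        obtain ⟨d, hd⟩ : ∃ d, d * step l d - (d + 1) * step l (d + 1) + step l (1 - d) ≠ 0 := by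
          by_contra! hall
          exact hcon (const_of_moment_eq_zero hp hsym hall)
        refine mem_of_moment_ne_zero hspan hrot (hpairs 0 d) (hsum 0 d) ?_ hv
        rw [h.moment_pairs_dirQuot hπ, zero_mul, zero_add, sub_zero]
        exact smul_ne_zero hd h0
  -- A constant e' forces a symmetric e'', so both indicators are 0 in this case.
  · have hcon : ¬ ∃ m, ∀ k, k ≠ 0 → k ≠ 1 → step l k = m :=
      fun ⟨m, hm⟩ => hsym (step₂_symm_of_const hm)
    rw [if_neg hsym, if_neg hcon, add_zero, Nat.sub_zero, cycDiff_pow_eq_zero]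
    refine ⟨fun _ => rfl, fun _ => ?_⟩
    push Not at hsym
    obtain ⟨d, hd⟩ := hsym
    refine mem_of_sum_ne_zero hspan hrot (hpairs 0 d) ?_ v
    rw [h.sum_pairs_dirQuot hπ, sub_zero]
    exact smul_ne_zero (sub_ne_zero.2 hd) h0

end SectionGroups
end Main
/-! ## Sections of elements of a GGS-group -/

section Tree

variable {X : Type}

theorem mem_stab_one_iff (g : TreeAut X) : g ∈ stab X 1 ↔ ∀ x, g [x] = [x] := by
  refine ⟨fun h x => h [x] rfl, fun h u hu => ?_⟩
  obtain ⟨x, rfl⟩ := List.length_eq_one_iff.1 hu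
  exact h x

variable [Finite X]

theorem sect_eq {g s : TreeAut X} {u : List X} (h : ∀ v, g (u ++ v) = g u ++ s v) : sect g u = s := by
  ext1 v
  exact List.append_cancel_left ((apply_append g u v).symm.trans (h v))

theorem sect_mul (g h : TreeAut X) (u : List X) : sect (g * h) u = sect g (h u) * sect h u :=
  sect_eq fun v => by
    rw [RelIso.mul_apply, RelIso.mul_apply, RelIso.mul_apply, apply_append h, apply_append g]

theorem exists_apply_singleton (g : TreeAut X) (x : X) : ∃ y, g [x] = [y] :=
  List.length_eq_one_iff.1 (map_append g [x] []).2

end Tree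

section Concrete

open scoped commutatorElement

variable {p : ℕ}

theorem genA_apply (x : Fin p) (v : List (Fin p)) : genA p (x :: v) = finRotate p x :: v := rfl

theorem sect_genA (x : Fin p) : sect (genA p) [x] = 1 := sect_eq fun _ => rfl

variable (e : Fin (p - 1) → ZMod p)

theorem genA_mem : genA p ∈ ggs e := Subgroup.subset_closure (Or.inl rfl)

theorem genB_mem : genB e ∈ ggs e := Subgroup.subset_closure (Or.inr rfl)

/-! ## The quotient of the derived subgroup -/

theorem map_der_top : (der (⊤ : Subgroup (ggs e))).map (ggs e).subtype = der (ggs e) := by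
  rw [der, Subgroup.map_commutator, ← MonoidHom.range_eq_map, Subgroup.range_subtype, der]

theorem map_gamma3_top : (gamma3 (⊤ : Subgroup (ggs e))).map (ggs e).subtype = gamma3 (ggs e) := by
  rw [gamma3, Subgroup.map_commutator, Subgroup.map_commutator, ← MonoidHom.range_eq_map,
    Subgroup.range_subtype, gamma3]

theorem map_der_der_top :
    (der (der (⊤ : Subgroup (ggs e)))).map (ggs e).subtype = der (der (ggs e)) := by
  change ⁅der (⊤ : Subgroup (ggs e)), der (⊤ : Subgroup (ggs e))⁆.map _ = ⁅der (ggs e), der (ggs e)⁆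
  rw [Subgroup.map_commutator, map_der_top]

variable {e}

theorem coe_mem_der {g : ggs e} : (g : TreeAut (Fin p)) ∈ der (ggs e) ↔ g ∈ der (⊤ : Subgroup (ggs e)) := by
  rw [← map_der_top]
  exact Subgroup.mem_map_iff_mem (Subgroup.subtype_injective _)

theorem coe_mem_gamma3 {g : ggs e} :
    (g : TreeAut (Fin p)) ∈ gamma3 (ggs e) ↔ g ∈ gamma3 (⊤ : Subgroup (ggs e)) := by
  rw [← map_gamma3_top]
  exact Subgroup.mem_map_iff_mem (Subgroup.subtype_injective _)

variable (e)

/-- The quotient map from the derived subgroup. -/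
def derClass : der (⊤ : Subgroup (ggs e)) →* Multiplicative (DerQuot (ggs e)) where
  toFun g := Multiplicative.ofAdd (toDerQuot (ggs e) ⟨g.1.1, coe_mem_der.2 g.2⟩)
  map_one' := rfl
  map_mul' _ _ := rfl

theorem derClass_eq_one_iff (g : der (⊤ : Subgroup (ggs e))) :
    derClass e g = 1 ↔ (g : ggs e) ∈ gamma3 (⊤ : Subgroup (ggs e)) := by
  rw [← coe_mem_gamma3]
  have h := toDerQuot_eq (ggs e) 1 ⟨g.1.1, coe_mem_der.2 g.2⟩
  rw [OneMemClass.coe_one, inv_one, one_mul] at h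
  rw [← h, eq_comm]
  rfl

theorem derClass_surjective : Function.Surjective (derClass e) := by
  rintro ⟨⟨g, hg⟩⟩
  exact ⟨⟨⟨g, der_le _ hg⟩, coe_mem_der.1 hg⟩, rfl⟩

/-! ## First-level sections -/

/-- The stabiliser of the first level in a GGS-group. -/
def levelStab : Subgroup (ggs e) := (stab (Fin p) 1).subgroupOf (ggs e)

/-- The generator `a` as an element of the group. -/
def elA : ggs e := ⟨genA p, genA_mem e⟩

/-- The generator `b` as an element of the group. -/
def elB : ggs e := ⟨genB e, genB_mem e⟩

theorem elA_pow : elA e ^ p = 1 := Subtype.ext (genA_pow p)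

theorem closure_elA_elB : Subgroup.closure {elA e, elB e} = ⊤ := by
  have : ({elA e, elB e} : Set (ggs e)) = (Subtype.val ⁻¹' {genA p, genB e}) := by
    ext x
    simp [elA, elB, Subtype.ext_iff]
  rw [this]
  exact Subgroup.closure_closure_coe_preimage

variable {e}

theorem levelStab_apply (g : levelStab e) (x : Fin p) : (g : ggs e).1 [x] = [x] :=
  (mem_stab_one_iff _).1 (Subgroup.mem_subgroupOf.1 g.2) x

instance : (levelStab e).Normal where
  conj_mem n hn g := by
    refine Subgroup.mem_subgroupOf.2 ((mem_stab_one_iff _).2 fun x => ?_)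
    change g.1 (n.1 (g.1⁻¹ [x])) = [x]
    obtain ⟨y, hy⟩ := exists_apply_singleton g.1⁻¹ x
    rw [hy, levelStab_apply ⟨n, hn⟩, ← hy]
    exact g.1.apply_symm_apply _

theorem conj_elA_mem {g : ggs e} (hg : g ∈ levelStab e) : elA e * g * (elA e)⁻¹ ∈ levelStab e :=
  Subgroup.Normal.conj_mem inferInstance g hg _

variable [Fact p.Prime]

/-- The letter that corresponds to a residue class. -/
def letter (k : ZMod p) : Fin p := ⟨k.val, ZMod.val_lt k⟩

theorem letter_cast (x : Fin p) : letter ((x : ℕ) : ZMod p) = x :=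
  Fin.ext (ZMod.val_cast_of_lt x.2)

theorem finRotate_letter (k : ZMod p) : finRotate p (letter k) = letter (k + 1) := by
  obtain ⟨q, hq⟩ : ∃ q, p = q + 1 := ⟨p - 1, (Nat.sub_add_cancel (Fact.out : p.Prime).one_le).symm⟩
  subst hq
  exact finRotate_apply _

theorem genA_letter (k : ZMod p) : genA p [letter k] = [letter (k + 1)] := by
  rw [genA_apply, finRotate_letter]

variable (e)

theorem genB_apply_letter (k : ZMod p) (v : List (Fin p)) : genB e (letter k :: v) =
    letter k :: (if k = 0 then genB e else modPow (genA p) (extend e k)) v := by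
  change dirFun e (letter k :: v) = _
  by_cases h : k = 0
  · subst h
    rw [dirFun, dif_pos (by simp [letter]), if_pos rfl]
    rfl
  · have h' : (letter k : ℕ) ≠ 0 := fun h' => h ((ZMod.val_eq_zero k).1 h')
    rw [dirFun, dif_neg h', if_neg h, extend, dif_neg h]
    rfl

theorem genB_letter (k : ZMod p) : genB e [letter k] = [letter k] := by
  rw [genB_apply_letter, map_nil]

theorem genB_mem_stab : genB e ∈ stab (Fin p) 1 :=
  (mem_stab_one_iff _).2 fun x => by rw [← letter_cast x, genB_letter]

theorem sect_genB (k : ZMod p) :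
    sect (genB e) [letter k] = if k = 0 then genB e else modPow (genA p) (extend e k) := by
  refine sect_eq fun v => ?_
  rw [genB_letter]
  exact genB_apply_letter e k v

variable {e}

theorem exists_apply_letter {g : TreeAut (Fin p)} (hg : g ∈ ggs e) :
    ∃ t : ZMod p, ∀ k, g [letter k] = [letter (k + t)] := by
  induction hg using Subgroup.closure_induction with
  | mem s hs =>
    rcases hs with rfl | rfl
    · exact ⟨1, genA_letter⟩
    · exact ⟨0, fun k => by rw [genB_letter, add_zero]⟩
  | one => exact ⟨0, fun k => by rw [add_zero]; rfl⟩
  | mul g h _ _ ihg ihh =>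
    obtain ⟨s, hs⟩ := ihg
    obtain ⟨t, ht⟩ := ihh
    exact ⟨t + s, fun k => by rw [RelIso.mul_apply, ht, hs, add_assoc]⟩
  | inv g _ ih =>
    obtain ⟨t, ht⟩ := ih
    refine ⟨-t, fun k => ?_⟩
    have : g⁻¹ (g [letter (k + -t)]) = [letter (k + -t)] := g.symm_apply_apply _
    rwa [ht, neg_add_cancel_right] at this

theorem sect_mem {g : TreeAut (Fin p)} (hg : g ∈ ggs e) (x : Fin p) : sect g [x] ∈ ggs e := by
  induction hg using Subgroup.closure_induction generalizing x with
  | mem s hs =>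
    rcases hs with rfl | rfl
    · rw [sect_genA]; exact one_mem _
    · rw [← letter_cast x, sect_genB]
      split_ifs
      · exact genB_mem e
      · exact pow_mem (genA_mem e) _
  | one =>
    have : sect (1 : TreeAut (Fin p)) [x] = 1 := sect_eq fun _ => rfl
    rw [this]; exact one_mem _
  | mul g h _ _ ihg ihh =>
    obtain ⟨y, hy⟩ := exists_apply_singleton h x
    rw [sect_mul, hy]
    exact mul_mem (ihg y) (ihh x)
  | inv g _ ih =>
    obtain ⟨y, hy⟩ := exists_apply_singleton g⁻¹ x
    have h1 : sect (g * g⁻¹) [x] = 1 := by rw [mul_inv_cancel]; exact sect_eq fun _ => rfl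
    rw [sect_mul, hy] at h1
    rw [← inv_eq_of_mul_eq_one_right h1]
    exact inv_mem (ih y)

variable (e)

/-- The tuple of first-level sections. -/
def sections : levelStab e →* (ZMod p → ggs e) where
  toFun g := fun k => ⟨sect (g : ggs e).1 [letter k], sect_mem (g : ggs e).2 _⟩
  map_one' := by
    funext k
    exact Subtype.ext (sect_eq fun _ => rfl)
  map_mul' g h := by
    funext k
    apply Subtype.ext
    change sect ((g : ggs e).1 * (h : ggs e).1) [letter k] = _
    rw [sect_mul, levelStab_apply]
    rfl

theorem elB_mem : elB e ∈ levelStab e := Subgroup.mem_subgroupOf.2 (genB_mem_stab e)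

theorem sections_elB : sections e ⟨elB e, elB_mem e⟩ = dirSect (extend e) (elA e) (elB e) 0 := by
  funext k
  apply Subtype.ext
  change sect (genB e) [letter k] = _
  rw [sect_genB, dirSect, sub_zero]
  split_ifs <;> rfl

variable {e}

/-- Elements of G act on the first level as rotations, so a suitable power of a corrects any of them
to a stabilising element. -/
theorem exists_eq_mul_pow (g : ggs e) : ∃ s ∈ levelStab e, ∃ n : ℕ, g = s * elA e ^ n := by
  obtain ⟨t, ht⟩ := exists_apply_letter g.2
  have hA : ∀ n : ℕ, ∀ k : ZMod p, (genA p ^ n) [letter k] = [letter (k + (n : ZMod p))] := by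
    intro n
    induction n with
    | zero => intro k; rw [Nat.cast_zero, add_zero]; rfl
    | succ n ih => intro k; rw [pow_succ', RelIso.mul_apply, ih, genA_letter]; push_cast; rw [add_assoc]
  refine ⟨g * (elA e ^ t.val)⁻¹, ?_, t.val, by rw [inv_mul_cancel_right]⟩
  refine Subgroup.mem_subgroupOf.2 ((mem_stab_one_iff _).2 fun x => ?_)
  obtain ⟨k, rfl⟩ : ∃ k : ZMod p, x = letter (k + t) :=
    ⟨((x : ℕ) : ZMod p) - t, by rw [sub_add_cancel, letter_cast]⟩
  have h1 := hA t.val k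
  rw [ZMod.natCast_zmod_val] at h1
  change g.1 ((genA p ^ t.val)⁻¹ [letter (k + t)]) = _
  have h2 : (genA p ^ t.val)⁻¹ ((genA p ^ t.val) [letter k]) = [letter k] :=
    (genA p ^ t.val).symm_apply_apply _
  rw [h1] at h2
  rw [h2, ht]

theorem sections_conj_elA (g : levelStab e) :
    sections e ⟨elA e * g.1 * (elA e)⁻¹, conj_elA_mem g.2⟩ = rot p (ggs e) (sections e g) := by
  funext k
  apply Subtype.ext
  change sect (genA p * g.1.1 * (genA p)⁻¹) [letter k] = sect g.1.1 [letter (k - 1)]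
  have h1 : (genA p)⁻¹ [letter k] = [letter (k - 1)] := by
    have : (genA p)⁻¹ (genA p [letter (k - 1)]) = [letter (k - 1)] := (genA p).symm_apply_apply _
    rwa [genA_letter, sub_add_cancel] at this
  have h2 : sect (genA p)⁻¹ [letter k] = 1 := by
    have h3 : sect (genA p * (genA p)⁻¹) [letter k] = 1 := by
      rw [mul_inv_cancel]; exact sect_eq fun _ => rfl
    rwa [sect_mul, h1, sect_genA, one_mul] at h3
  rw [sect_mul, h1, h2, mul_one, sect_mul, levelStab_apply g, sect_genA, one_mul]

variable (e)

theorem commutator_elB_elA_mem : ⁅elB e, elA e⁆ ∈ levelStab e := by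
  have h := mul_mem (elB_mem e) (conj_elA_mem (inv_mem (elB_mem e)))
  rw [commutatorElement_def]
  simpa [mul_assoc] using h

theorem der_top_le : der (⊤ : Subgroup (ggs e)) ≤ levelStab e := by
  refine commutator_le_of_generators (a := elB e) (b := elA e) ?_ _ (commutator_elB_elA_mem e)
  rw [Set.pair_comm]
  exact closure_elA_elB e

/-- The tuples of first-level sections of the elements of the derived subgroup. -/
def derSections : Subgroup (ZMod p → ggs e) :=
  ((der (⊤ : Subgroup (ggs e))).subgroupOf (levelStab e)).map (sections e)

variable {e}

theorem rot_dirSect {A : Type*} [Group A] (l : ZMod p → ZMod p) (a b : A) (i : ZMod p) :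
    rot p A (dirSect l a b i) = dirSect l a b (i + 1) := by
  funext k
  rw [rot_apply, dirSect, dirSect, sub_sub, add_comm 1 i]
  simp only [sub_eq_iff_eq_add]

theorem rot_dirQuot {A : Type*} [Group A] (l : ZMod p → ZMod p) (a b : A) (i : ZMod p) :
    rot p A (dirQuot l a b i) = dirQuot l a b (i + 1) := by
  rw [dirQuot, map_mul, map_inv, rot_dirSect, rot_dirSect, dirQuot]

theorem forall_of_zero_of_succ {P : ZMod p → Prop} (h0 : P 0) (hs : ∀ i, P i → P (i + 1)) (i : ZMod p) :
    P i := by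
  have : ∀ n : ℕ, P n := by
    intro n
    induction n with
    | zero => simpa using h0
    | succ n ih => simpa using hs _ ih
  rw [← ZMod.natCast_zmod_val i]
  exact this _

variable (e)

theorem rot_range_sections : (sections e).range.map (rot p (ggs e)) ≤ (sections e).range := by
  rintro _ ⟨_, ⟨g, rfl⟩, rfl⟩
  exact ⟨⟨_, conj_elA_mem g.2⟩, sections_conj_elA g⟩

theorem dirSect_mem_range (i : ZMod p) :
    dirSect (extend e) (elA e) (elB e) i ∈ (sections e).range := by
  refine forall_of_zero_of_succ (P := fun i => dirSect _ _ _ i ∈ (sections e).range)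
    ⟨_, sections_elB e⟩ (fun i hi => ?_) i
  rw [← rot_dirSect]
  exact rot_range_sections e (Subgroup.mem_map_of_mem _ hi)

/-- [b, a] = b (a b a⁻¹)⁻¹, and conjugation by a rotates the sections. -/
theorem sections_commutator :
    sections e ⟨⁅elB e, elA e⁆, commutator_elB_elA_mem e⟩ = dirQuot (extend e) (elA e) (elB e) 0 := by
  have h1 : (⟨⁅elB e, elA e⁆, commutator_elB_elA_mem e⟩ : levelStab e) =
      ⟨elB e, elB_mem e⟩ * ⟨elA e * elB e * (elA e)⁻¹, conj_elA_mem (elB_mem e)⟩⁻¹ := by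
    apply Subtype.ext
    change ⁅elB e, elA e⁆ = elB e * (elA e * elB e * (elA e)⁻¹)⁻¹
    simp [commutatorElement_def, mul_assoc]
  rw [h1, map_mul, map_inv, sections_conj_elA ⟨elB e, elB_mem e⟩, sections_elB, rot_dirSect, dirQuot]

theorem rot_derSections : (derSections e).map (rot p (ggs e)) ≤ derSections e := by
  rintro _ ⟨_, ⟨g, hg, rfl⟩, rfl⟩
  refine ⟨_, ?_, sections_conj_elA g⟩
  have hn : (der (⊤ : Subgroup (ggs e))).Normal := Subgroup.commutator_normal ⊤ ⊤
  exact Subgroup.mem_subgroupOf.2 (hn.conj_mem _ (Subgroup.mem_subgroupOf.1 hg) _)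

/-- G' is the normal closure of [b, a]. The stabilising elements with sections in the closure on the
right form a normal subgroup of G containing [b, a]: conjugation by the stabiliser preserves the
closure, conjugation by a rotates it, and these generate G. -/
theorem derSections_le_closure : derSections e ≤ Subgroup.closure {x | ∃ s ∈ (sections e).range,
    ∃ i, x = s * dirQuot (extend e) (elA e) (elB e) i * s⁻¹} := by
  set C := Subgroup.closure {x | ∃ s ∈ (sections e).range,
    ∃ i, x = s * dirQuot (extend e) (elA e) (elB e) i * s⁻¹} with hC
  let N : Subgroup (ggs e) := (C.comap (sections e)).map (levelStab e).subtype
  have hCconj : ∀ s ∈ (sections e).range, ∀ x ∈ C, s * x * s⁻¹ ∈ C := by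
    intro s hs
    have : C ≤ C.comap (MulAut.conj s).toMonoidHom := by
      rw [hC, Subgroup.closure_le]
      rintro _ ⟨t, ht, i, rfl⟩
      refine Subgroup.subset_closure ⟨s * t, mul_mem hs ht, i, ?_⟩
      change s * _ * s⁻¹ = _
      simp [mul_assoc]
    exact fun x hx => this hx
  have hCrot : ∀ x ∈ C, rot p (ggs e) x ∈ C := by
    have : C ≤ C.comap (rot p (ggs e)) := by
      rw [hC, Subgroup.closure_le]
      rintro _ ⟨t, ht, i, rfl⟩
      refine Subgroup.subset_closure ⟨rot p (ggs e) t, rot_range_sections e ⟨t, ht, rfl⟩, i + 1, ?_⟩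
      rw [map_mul, map_mul, map_inv, rot_dirQuot]
    exact fun x hx => this hx
  have hNA : ∀ n : ℕ, ∀ x ∈ N, elA e ^ n * x * (elA e ^ n)⁻¹ ∈ N := by
    intro n
    induction n with
    | zero => intro x hx; simpa using hx
    | succ n ih =>
      intro x hx
      obtain ⟨y, hy, hyx⟩ := ih x hx
      refine ⟨⟨elA e * y.1 * (elA e)⁻¹, conj_elA_mem y.2⟩, ?_, ?_⟩
      · change sections e _ ∈ C
        rw [sections_conj_elA]
        exact hCrot _ hy
      · change elA e * y.1 * (elA e)⁻¹ = _
        have hyx' : y.1 = _ := hyx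
        rw [hyx', pow_succ']
        simp [mul_assoc]
  have hN : N.Normal := by
    refine ⟨fun x hx g => ?_⟩
    obtain ⟨s, hs, n, rfl⟩ := exists_eq_mul_pow g
    obtain ⟨y, hy, hyx⟩ := hNA n x hx
    refine ⟨⟨s, hs⟩ * y * ⟨s, hs⟩⁻¹, ?_, ?_⟩
    · change sections e _ ∈ C
      rw [map_mul, map_mul, map_inv]
      exact hCconj _ ⟨_, rfl⟩ _ hy
    · change s * y.1 * s⁻¹ = _
      have hyx' : y.1 = _ := hyx
      rw [hyx']
      simp [mul_assoc]
  have hle : der (⊤ : Subgroup (ggs e)) ≤ N := by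
    refine commutator_le_of_generators (a := elB e) (b := elA e) ?_ _ ?_
    · rw [Set.pair_comm]
      exact closure_elA_elB e
    · refine ⟨⟨_, commutator_elB_elA_mem e⟩, ?_, rfl⟩
      change sections e _ ∈ C
      rw [sections_commutator]
      exact Subgroup.subset_closure ⟨1, one_mem _, 0, by simp⟩
  rintro _ ⟨g, hg, rfl⟩
  obtain ⟨y, hy, hyg⟩ := hle (Subgroup.mem_subgroupOf.1 hg)
  have : y = g := Subtype.ext hyg
  rw [← this]
  exact hy

/-- The groups of sections of a GGS-group. -/
theorem sectionGroups (he : ¬ IsConst e) : SectionGroups (extend e) (elA e) (elB e)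
    (sections e).range (derSections e) where
  pow_a := elA_pow e
  pow_b := Subtype.ext (genB_pow e)
  closure_eq := closure_elA_elB e
  zero := extend_zero e
  step_ne := by
    by_contra! h
    exact he (isConst_of_step_eq_zero e h)
  mem := dirSect_mem_range e
  comm_le := by
    rw [MonoidHom.range_eq_map, ← Subgroup.map_commutator]
    refine Subgroup.map_mono (Subgroup.commutator_le.2 fun x _ y _ => ?_)
    exact Subgroup.mem_subgroupOf.2 (comm_mem (Subgroup.mem_top x.1) (Subgroup.mem_top y.1))
  le := Subgroup.map_le_range _ _
  rot_S := rot_range_sections e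
  rot_D := rot_derSections e
  quot_mem i := by
    refine forall_of_zero_of_succ (P := fun i => dirQuot _ _ _ i ∈ derSections e) ?_ (fun i hi => ?_) i
    · exact ⟨_, Subgroup.mem_subgroupOf.2 (comm_mem (Subgroup.mem_top _) (Subgroup.mem_top _)),
        sections_commutator e⟩
    · rw [← rot_dirQuot]
      exact rot_derSections e ⟨_, hi, rfl⟩
  le_closure := derSections_le_closure e

/-! ## Transfer to the letters -/

theorem comp_letter_pow {K : Type*} [AddCommGroup K] [Module (ZMod p) K] (n : ℕ) (v : Fin p → K) :
    ((shift (ZMod p) - 1 : (Fin p → K) →ₗ[ZMod p] (Fin p → K)) ^ n) v ∘ letter =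
      (cycDiff p K ^ n) (v ∘ letter) := by
  induction n with
  | zero => rfl
  | succ n ih =>
    rw [pow_succ', pow_succ', Module.End.mul_apply, Module.End.mul_apply, ← ih]
    funext k
    rw [cycDiff_apply]
    have : (finRotate p).symm (letter k) = letter (k - 1) := by
      rw [Equiv.symm_apply_eq, finRotate_letter, sub_add_cancel]
    have h2 : (((shift (ZMod p) - 1 : (Fin p → K) →ₗ[ZMod p] (Fin p → K)) ^ n) v)
      ((finRotate p).symm (letter k)) = (((shift (ZMod p) - 1 : (Fin p → K) →ₗ[ZMod p] (Fin p → K)) ^ n) v)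
      (letter (k - 1)) := by rw [this]
    exact congrArg (· - _) h2

theorem comp_letter_eq_zero_iff {K : Type*} [AddCommGroup K] (v : Fin p → K) :
    v ∘ letter = 0 ↔ v = 0 := by
  refine ⟨fun h => funext fun x => ?_, fun h => by rw [h]; rfl⟩
  have := congrFun h ((x : ℕ) : ZMod p)
  rwa [Function.comp_apply, letter_cast] at this

theorem mem_circLE_letter_iff {K : Type*} [AddCommGroup K] [Module (ZMod p) K]
    [FiniteDimensional (ZMod p) K] (m : ℕ) (v : Fin p → K) :
    v ∈ circLE (ZMod p) m ↔ (cycDiff p K ^ m) (v ∘ letter) = 0 := by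
  rw [mem_circLE_iff, ← comp_letter_pow, comp_letter_eq_zero_iff]
  refine ⟨p, LinearMap.ext fun w => ?_⟩
  rw [LinearMap.zero_apply, ← comp_letter_eq_zero_iff, comp_letter_pow, cycDiff_pow_eq_zero]

/-- Taking sections is a homomorphism on the stabiliser, which contains G', so it carries G'' onto
[D, D]. -/
theorem mem_psi_image_iff (g : Fin p → TreeAut (Fin p)) :
    g ∈ ((der (der (ggs e))).subgroupOf (stab (Fin p) 1)).map (psi (Fin p)) ↔
      ∃ z ∈ ⁅derSections e, derSections e⁆, ∀ k, g (letter k) = z k := by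
  let D := (der (⊤ : Subgroup (ggs e))).subgroupOf (levelStab e)
  have h1 : ⁅derSections e, derSections e⁆ = ⁅D, D⁆.map (sections e) := by
    rw [Subgroup.map_commutator]; rfl
  have h2 : ⁅D, D⁆.map (levelStab e).subtype = der (der (⊤ : Subgroup (ggs e))) := by
    rw [Subgroup.map_commutator, Subgroup.map_subgroupOf_eq_of_le (der_top_le e)]; rfl
  rw [h1]
  constructor
  · rintro ⟨y, hy, rfl⟩
    have hy' : (y : TreeAut (Fin p)) ∈ der (der (ggs e)) := hy
    rw [← map_der_der_top, ← h2] at hy'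
    obtain ⟨_, ⟨w, hw, rfl⟩, hwy⟩ := hy'
    refine ⟨sections e w, ⟨w, hw, rfl⟩, fun k => ?_⟩
    change sect y.1 [letter k] = sect w.1.1 [letter k]
    rw [← hwy]; rfl
  · rintro ⟨_, ⟨w, hw, rfl⟩, hz⟩
    refine ⟨⟨w.1.1, Subgroup.mem_subgroupOf.1 w.2⟩, ?_, ?_⟩
    · change w.1.1 ∈ der (der (ggs e))
      rw [← map_der_der_top, ← h2]
      exact ⟨_, ⟨w, hw, rfl⟩, rfl⟩
    · funext x
      have := hz (x : ℕ)
      rw [letter_cast] at this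
      rw [this]
      change sect w.1.1 [x] = sect w.1.1 [letter _]
      rw [letter_cast]

theorem con_diff_add_sym_diff_diff (hp : p ≠ 2)
    [Decidable (∃ m, ∀ k, k ≠ 0 → k ≠ 1 → step (extend e) k = m)]
    [Decidable (∀ k, step₂ (extend e) k = step₂ (extend e) (-k))] :
    con (diff e) + sym (diff (diff e)) =
      (if ∃ m, ∀ k, k ≠ 0 → k ≠ 1 → step (extend e) k = m then 1 else 0) +
        (if ∀ k, step₂ (extend e) k = step₂ (extend e) (-k) then 1 else 0) := by
  unfold con sym
  simp only [isConst_diff_iff, isSymm_diff_diff_iff hp]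

end Concrete

end GGS

/-! ### The main theorem -/

theorem mainTheorem5 (p : ℕ) [Fact p.Prime] (hp : p ≠ 2)
    (e : Fin (p - 1) → ZMod p) (he : ¬ GGS.IsConst e) :
    GGS.der (GGS.der (GGS.ggs e)) ≤ GGS.stab (Fin p) 1 ∧
    (((GGS.der (GGS.der (GGS.ggs e))).subgroupOf (GGS.stab (Fin p) 1)).map (GGS.psi (Fin p)) :
        Set (Fin p → GGS.TreeAut (Fin p))) =
      {g | ∃ hg : ∀ x, g x ∈ GGS.der (GGS.ggs e),
        (fun x => GGS.toDerQuot (GGS.ggs e) ⟨g x, hg x⟩) ∈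
          GGS.circLE (ZMod p)
            (p - (GGS.con (GGS.diff e) + GGS.sym (GGS.diff (GGS.diff e))))} := by
  classical
  have h := GGS.sectionGroups e he
  have hπ := GGS.derClass_eq_one_iff e
  have hs := GGS.derClass_surjective e
  -- Needed because `Module.finrank` is 0 on infinite-dimensional spaces; the class of [a, b] spans
  -- the quotient.
  have hfin : FiniteDimensional (ZMod p) (GGS.DerQuot (GGS.ggs e)) := by
    refine ⟨⟨{GGS.pair (GGS.derClass e) (GGS.elA e) (GGS.elB e)}, ?_⟩⟩
    rw [eq_top_iff]
    intro v _
    obtain ⟨t, rfl⟩ := GGS.exists_eq_smul_pair (p := p) hπ hs h.closure_eq v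
    exact Submodule.smul_mem _ _ (Submodule.subset_span (by simp))
  constructor
  · intro g hg
    rw [← GGS.map_der_der_top] at hg
    obtain ⟨w, hw, rfl⟩ := hg
    exact Subgroup.mem_subgroupOf.1 (GGS.der_top_le e (GGS.der_le _ hw))
  · ext g
    rw [SetLike.mem_coe, GGS.mem_psi_image_iff, Set.mem_ofPred_eq,
      GGS.con_diff_add_sym_diff_diff e hp]
    simp only [GGS.mem_circLE_letter_iff]
    constructor
    · rintro ⟨z, hz, hgz⟩
      have hder := GGS.mem_der_of_mem_commutator hz
      refine ⟨fun x => ?_, ?_⟩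
      · rw [← GGS.letter_cast x, hgz]
        exact GGS.coe_mem_der.2 (hder _)
      · have h1 := (h.mem_image_D_iff hp hπ hs _).1 (GGS.mem_image.2 ⟨z, hz, hder, rfl⟩)
        convert h1 using 2
        funext k
        change GGS.toDerQuot _ _ = GGS.toDerQuot _ _
        congr 1
        exact Subtype.ext (hgz k)
    · rintro ⟨hg, h1⟩
      let z : ZMod p → GGS.ggs e := fun k => ⟨g (GGS.letter k), GGS.der_le _ (hg _)⟩
      have hder : ∀ k, z k ∈ GGS.der (⊤ : Subgroup (GGS.ggs e)) := fun k => GGS.coe_mem_der.1 (hg _)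
      refine ⟨z, ?_, fun k => rfl⟩
      -- The condition on classes suffices because [D, D] contains all tuples over γ₃(G).
      refine GGS.mem_of_classes_mem_image hπ (GGS.map_rot_commutator_le h.rot_D)
        (h.gamma3_le_rist_D hp hπ hs) hder ?_
      rw [h.mem_image_D_iff hp hπ hs]
      convert h1 using 2
      rfl
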